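/- Let $\tilde H_1=\{u\in C^2[0,1]: u(0)=u'(0)=0\}$ and $\tilde H_2=\{u\in C^1[0,1]: u(0)=0\}$ (complex-valued functions), with the inner products $(u|v)_1=\int_0^1 u'(\rho)\overline{v'(\rho)}\,\frac{d\rho}{\rho^2}$ and $(u|v)_2=\int_0^1 u'(\rho)\overline{v'(\rho)}\,d\rho$, and let $\mathcal H$ be the Hilbert space obtained by completing $\tilde{\mathcal H}=\tilde H_1\times\tilde H_2$ with respect to $(\mathbf u|\mathbf v)=(u_1|v_1)_1+(u_2|v_2)_2$. Let $\tilde L_0$ be the unbounded operator in $\mathcal H$ with domain $$\mathcal D(\tilde L_0)=\{u\in C^3[0,1]: u(0)=u'(0)=u''(0)=0\}\times\{u\in C^3[0,1]: u(0)=0\}$$ given by $$\tilde L_0\mathbf u(\rho)=\begin{pmatrix}-\rho u_1'(\rho)+u_1(\rho)+\rho u_2'(\rho)-u_2(\rho)\\ \frac1\rho u_1'(\rho)-\rho u_2'(\rho)\end{pmatrix},$$ let $L_0$ be its closure, let $L'\in\mathcal B(\mathcal H)$ be the bounded extension of $$L'\mathbf u(\rho)=\begin{pmatrix}-V_1(\rho)\int_0^\rho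 \rho' u_2(\rho')\,d\rho'\\ 0\end{pmatrix},\quad \mathbf u\in\tilde{\mathcal H},\qquad V_1(\rho)=-\frac{16}{(1+\rho^2)^2},$$ and let $L=L_0+L'$ with domain $\mathcal D(L_0)$. Write $\sigma(L)$ for the spectrum of $L$ and $R_L(\lambda)=(\lambda-L)^{-1}\in\mathcal B(\mathcal H)$ for its resolvent. Then for every $\varepsilon>0$: 1. there are constants $M,C$ such that for all $\lambda\in\mathbb C$ with $\operatorname{Re}\lambda\ge-\frac12+\varepsilon$ and $|\lambda|\ge M$ the resolvent $R_L(\lambda)$ exists and $\|R_L(\lambda)\|\le C$; 2. in particular, there is a constant $N$ such that no $\lambda\in\mathbb C$ with $\operatorname{Re}\lambda\ge-\frac12+\varepsilon$ and $|\operatorname{Im}\lambda|\ge N$ belongs to $\sigma(L)$. Hence there is a constant $N$ such that $L$ has no eigenvalue $\lambda$ with $\operatorname{Re}\lambda\ge0$ and $|\operatorname{Im}\lambda|\ge N$. -/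

import Mathlib

open Set Filter Topology MeasureTheory
open scoped ComplexConjugate InnerProductSpace

namespace WaveMap

/-- The closed unit interval of the radial variable `ρ`. -/
abbrev I : Set ℝ := Icc 0 1

/-- The derivative `u'` on `[0,1]`, one-sided at the end points. -/
noncomputable def D (u : ℝ → ℂ) : ℝ → ℂ := derivWithin u I

/-- `C^k[0,1]`: complex-valued functions that are `k` times continuously differentiable on `[0,1]`
up to the end points. Outside `[0,1]` they are set to zero, so that an element is nothing but
a function on `[0,1]`. -/
def Ck (k : ℕ) : Submodule ℂ (ℝ → ℂ) where
  carrier := {u | ContDiffOn ℝ k u I ∧ ∀ ρ ∉ I, u ρ = 0}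
  add_mem' := fun hu hv =>
    ⟨hu.1.add hv.1, fun ρ hρ => by simp [hu.2 ρ hρ, hv.2 ρ hρ]⟩
  zero_mem' := ⟨contDiffOn_const, fun _ _ => rfl⟩
  smul_mem' := fun c u hu => ⟨hu.1.const_smul c, fun ρ hρ => by simp [hu.2 ρ hρ]⟩

theorem uniqueDiff : UniqueDiffOn ℝ I := uniqueDiffOn_Icc one_pos

theorem zero_mem_I : (0 : ℝ) ∈ I := ⟨le_rfl, zero_le_one⟩

theorem contDiffOn_D {u : ℝ → ℂ} {n m : ℕ} (hu : ContDiffOn ℝ n u I) (h : m + 1 ≤ n) :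
    ContDiffOn ℝ m (D u) I :=
  hu.derivWithin uniqueDiff (by exact_mod_cast h)

theorem diffOn {u : ℝ → ℂ} {n : ℕ} (hu : ContDiffOn ℝ n u I) (h : 1 ≤ n) :
    DifferentiableOn ℝ u I :=
  hu.differentiableOn (by have : n ≠ 0 := by omega
                          exact_mod_cast this)

theorem hasD {u : ℝ → ℂ} {n : ℕ} (hu : ContDiffOn ℝ n u I) (h : 1 ≤ n) {ρ : ℝ} (hρ : ρ ∈ I) :
    HasDerivWithinAt u (D u ρ) I ρ :=
  (diffOn hu h ρ hρ).hasDerivWithinAt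

theorem D_eq {u : ℝ → ℂ} {c : ℂ} {ρ : ℝ} (hρ : ρ ∈ I) (h : HasDerivWithinAt u c I ρ) :
    D u ρ = c :=
  h.derivWithin (uniqueDiff ρ hρ)

theorem D_congr {u v : ℝ → ℂ} (h : EqOn u v I) {ρ : ℝ} (hρ : ρ ∈ I) : D u ρ = D v ρ :=
  derivWithin_congr h (h hρ)

theorem D_add {u v : ℝ → ℂ} {n : ℕ} (hn : 1 ≤ n) (hu : ContDiffOn ℝ n u I)
    (hv : ContDiffOn ℝ n v I) {ρ : ℝ} (hρ : ρ ∈ I) : D (u + v) ρ = D u ρ + D v ρ :=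
  D_eq hρ ((hasD hu hn hρ).add (hasD hv hn hρ))

theorem D_smul {u : ℝ → ℂ} {n : ℕ} (hn : 1 ≤ n) (c : ℂ) (hu : ContDiffOn ℝ n u I)
    {ρ : ℝ} (hρ : ρ ∈ I) : D (c • u) ρ = c * D u ρ :=
  D_eq hρ ((hasD hu hn hρ).const_smul c)

theorem norm_le_mul {g : ℝ → ℂ} (hg : ContDiffOn ℝ (1 : ℕ) g I) (h0 : g 0 = 0) :
    ∃ C : ℝ, 0 ≤ C ∧ ∀ ρ ∈ I, ‖g ρ‖ ≤ C * ρ := by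
  obtain ⟨C, hC⟩ := (isCompact_Icc (a := (0 : ℝ)) (b := 1)).exists_bound_of_continuousOn
    (contDiffOn_D hg (m := 0) (by norm_num)).continuousOn
  refine ⟨C, (norm_nonneg _).trans (hC 0 zero_mem_I), fun ρ hρ => ?_⟩
  have := (convex_Icc (0 : ℝ) 1).norm_image_sub_le_of_norm_hasDerivWithin_le
    (fun x hx => hasD hg le_rfl hx) hC zero_mem_I hρ
  simpa [h0, abs_of_nonneg hρ.1] using this

theorem eq_zero_of_D_ae {u : ℝ → ℂ} {n : ℕ} (hn : 1 ≤ n) (hu : u ∈ Ck n) (h0 : u 0 = 0)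
    (h : ∀ᵐ ρ ∂(volume.restrict (Ioc (0 : ℝ) 1)), D u ρ = 0) : u = 0 := by
  funext ρ
  by_cases hρ : ρ ∈ I
  swap
  · exact hu.2 ρ hρ
  have hc : ContinuousOn (D u) I := (contDiffOn_D hu.1 (m := 0) (by omega)).continuousOn
  have hsub : Icc 0 ρ ⊆ I := Icc_subset_Icc_right hρ.2
  have h1 : ∫ x in (0 : ℝ)..ρ, D u x = u ρ - u 0 := by
    refine intervalIntegral.integral_eq_sub_of_hasDerivAt_of_le hρ.1
      (hu.1.continuousOn.mono hsub) (fun x hx => ?_) ?_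
    · have hx' : x ∈ Ioo (0 : ℝ) 1 := ⟨hx.1, hx.2.trans_le hρ.2⟩
      exact (hasD hu.1 hn (Ioo_subset_Icc_self hx')).hasDerivAt (Icc_mem_nhds hx'.1 hx'.2)
    · exact (hc.mono hsub).intervalIntegrable_of_Icc hρ.1
  have h2 : ∫ x in (0 : ℝ)..ρ, D u x = 0 := by
    rw [intervalIntegral.integral_of_le hρ.1]
    refine integral_eq_zero_of_ae ?_
    exact ae_restrict_of_ae_restrict_of_subset (Ioc_subset_Ioc_right hρ.2) h
  rw [h2, h0, sub_zero] at h1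
  exact h1.symm

/-- `{u ∈ C²[0,1] : u(0) = u'(0) = 0}` as a subspace of the functions. -/
noncomputable def preH1 : Submodule ℂ (ℝ → ℂ) where
  carrier := {u | u ∈ Ck 2 ∧ u 0 = 0 ∧ D u 0 = 0}
  add_mem' := fun {u v} hu hv => ⟨add_mem hu.1 hv.1, by simp [hu.2.1, hv.2.1], by
    rw [D_add (n := 2) (by norm_num) hu.1.1 hv.1.1 zero_mem_I, hu.2.2, hv.2.2, add_zero]⟩
  zero_mem' := ⟨zero_mem _, rfl, by simp [D, derivWithin_zero]⟩
  smul_mem' := fun c u hu => ⟨Submodule.smul_mem _ c hu.1, by simp [hu.2.1], by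
    rw [D_smul (n := 2) (by norm_num) c hu.1.1 zero_mem_I, hu.2.2, mul_zero]⟩

/-- `{u ∈ C¹[0,1] : u(0) = 0}` as a subspace of the functions. -/
noncomputable def preH2 : Submodule ℂ (ℝ → ℂ) where
  carrier := {u | u ∈ Ck 1 ∧ u 0 = 0}
  add_mem' := fun {u v} hu hv => ⟨add_mem hu.1 hv.1, by simp [hu.2, hv.2]⟩
  zero_mem' := ⟨zero_mem _, rfl⟩
  smul_mem' := fun c u hu => ⟨Submodule.smul_mem _ c hu.1, by simp [hu.2]⟩

/-- The space `H̃₁` (a type of its own, so that it carries no other topology than the one of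
the inner product below). -/
noncomputable def H1t : Type := preH1

/-- The space `H̃₂` (a type of its own, for the same reason). -/
noncomputable def H2t : Type := preH2

noncomputable instance : AddCommGroup H1t := inferInstanceAs (AddCommGroup preH1)
noncomputable instance : Module ℂ H1t := inferInstanceAs (Module ℂ preH1)
noncomputable instance : AddCommGroup H2t := inferInstanceAs (AddCommGroup preH2)
noncomputable instance : Module ℂ H2t := inferInstanceAs (Module ℂ preH2)

/-- The underlying function of an element of `H̃₁`. -/
noncomputable def H1t.fn : H1t →ₗ[ℂ] (ℝ → ℂ) := preH1.subtype

/-- The underlying function of an element of `H̃₂`. -/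
noncomputable def H2t.fn : H2t →ₗ[ℂ] (ℝ → ℂ) := preH2.subtype

theorem H1t.mem (u : H1t) : u.fn ∈ preH1 := u.2

theorem H2t.mem (u : H2t) : u.fn ∈ preH2 := u.2

theorem H1t.fn_injective : Function.Injective H1t.fn := Subtype.val_injective

theorem H2t.fn_injective : Function.Injective H2t.fn := Subtype.val_injective

theorem contOn_D1 (u : H1t) : ContinuousOn (D u.fn) I :=
  (contDiffOn_D u.mem.1.1 (m := 0) (by norm_num)).continuousOn

theorem contOn_D2 (u : H2t) : ContinuousOn (D u.fn) I :=
  (contDiffOn_D u.mem.1.1 (m := 0) (by norm_num)).continuousOn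

theorem integrable1 (u v : H1t) :
    IntervalIntegrable (fun ρ : ℝ => conj (D u.fn ρ) * D v.fn ρ / (ρ : ℂ) ^ 2) volume 0 1 := by
  obtain ⟨A, hA0, hA⟩ := norm_le_mul (contDiffOn_D u.mem.1.1 (m := 1) (by norm_num)) u.mem.2.2
  obtain ⟨B, hB0, hB⟩ := norm_le_mul (contDiffOn_D v.mem.1.1 (m := 1) (by norm_num)) v.mem.2.2
  rw [intervalIntegrable_iff_integrableOn_Ioc_of_le zero_le_one]
  refine IntegrableOn.of_bound (by simp) ?_ (A * B) ?_
  · have hc : ContinuousOn (fun ρ : ℝ => conj (D u.fn ρ) * D v.fn ρ / (ρ : ℂ) ^ 2)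
        (Ioc (0 : ℝ) 1) := by
      refine ContinuousOn.div ?_
        (Complex.continuous_ofReal.pow 2).continuousOn ?_
      · exact (Complex.continuous_conj.comp_continuousOn
          ((contOn_D1 u).mono Ioc_subset_Icc_self)).mul ((contOn_D1 v).mono Ioc_subset_Icc_self)
      · intro x hx
        have h0 : x ≠ 0 := ne_of_gt hx.1
        exact pow_ne_zero 2 (by exact_mod_cast h0)
    exact hc.aestronglyMeasurable measurableSet_Ioc
  · refine (ae_restrict_iff' measurableSet_Ioc).2 (ae_of_all _ fun x hx => ?_)
    have hx' := Ioc_subset_Icc_self hx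
    have h0 : (0 : ℝ) < x := hx.1
    rw [norm_div, norm_mul, norm_pow, Complex.norm_real, Real.norm_eq_abs, sq_abs,
      div_le_iff₀ (by positivity), RCLike.norm_conj]
    calc ‖D u.fn x‖ * ‖D v.fn x‖ ≤ (A * x) * (B * x) :=
          mul_le_mul (hA x hx') (hB x hx') (norm_nonneg _) (by positivity)
      _ = A * B * x ^ 2 := by ring

theorem integrable2 (u v : H2t) :
    IntervalIntegrable (fun ρ : ℝ => conj (D u.fn ρ) * D v.fn ρ) volume 0 1 :=
  ((Complex.continuous_conj.comp_continuousOn (contOn_D2 u)).mul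
    (contOn_D2 v)).intervalIntegrable_of_Icc zero_le_one

theorem self1 (u : H1t) : (∫ ρ in (0 : ℝ)..1, conj (D u.fn ρ) * D u.fn ρ / (ρ : ℂ) ^ 2) =
    ((∫ ρ in (0 : ℝ)..1, ‖D u.fn ρ‖ ^ 2 / ρ ^ 2 : ℝ) : ℂ) := by
  rw [← intervalIntegral.integral_ofReal]
  congr 1; funext ρ
  rw [RCLike.conj_mul]; push_cast; rfl

theorem self2 (u : H2t) : (∫ ρ in (0 : ℝ)..1, conj (D u.fn ρ) * D u.fn ρ) =
    ((∫ ρ in (0 : ℝ)..1, ‖D u.fn ρ‖ ^ 2 : ℝ) : ℂ) := by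
  rw [← intervalIntegral.integral_ofReal]
  congr 1; funext ρ
  rw [RCLike.conj_mul]; push_cast; rfl

theorem integrable1_self (u : H1t) :
    IntervalIntegrable (fun ρ : ℝ => ‖D u.fn ρ‖ ^ 2 / ρ ^ 2) volume 0 1 := by
  have h := (integrable1 u u).norm
  refine h.congr (fun ρ _ => ?_)
  simp [sq]

theorem integrable2_self (u : H2t) :
    IntervalIntegrable (fun ρ : ℝ => ‖D u.fn ρ‖ ^ 2) volume 0 1 := by
  have h := (integrable2 u u).norm
  refine h.congr (fun ρ _ => ?_)
  simp [sq]

/-- The inner product `(u|v)₁ = ∫₀¹ u' v̄' dρ/ρ²` on `H̃₁`; following Mathlib's convention it is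
conjugate linear in its first argument, so that `inner u v` is `(v|u)₁`. -/
@[reducible] noncomputable def core1 : InnerProductSpace.Core ℂ H1t where
  inner u v := ∫ ρ in (0 : ℝ)..1, conj (D u.fn ρ) * D v.fn ρ / (ρ : ℂ) ^ 2
  conj_inner_symm u v := by
    simp only [intervalIntegral.integral_of_le zero_le_one]
    rw [← integral_conj]
    congr 1; funext ρ
    simp [mul_comm]
  re_inner_nonneg u := by
    rw [self1]
    exact intervalIntegral.integral_nonneg zero_le_one fun ρ _ => by positivity
  add_left u v w := by
    rw [← intervalIntegral.integral_add (integrable1 u w) (integrable1 v w)]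
    refine intervalIntegral.integral_congr fun ρ hρ => ?_
    rw [uIcc_of_le zero_le_one] at hρ
    simp only [map_add]
    rw [D_add (n := 2) (by norm_num) u.mem.1.1 v.mem.1.1 hρ, map_add]
    ring
  smul_left u v c := by
    rw [← intervalIntegral.integral_const_mul]
    refine intervalIntegral.integral_congr fun ρ hρ => ?_
    rw [uIcc_of_le zero_le_one] at hρ
    simp only [map_smul]
    rw [D_smul (n := 2) (by norm_num) c u.mem.1.1 hρ, map_mul]
    ring
  definite u h := by
    rw [self1] at h
    have h' := Complex.ofReal_eq_zero.1 h
    rw [intervalIntegral.integral_eq_zero_iff_of_le_of_nonneg_ae zero_le_one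
      (ae_of_all _ fun ρ => by positivity) (integrable1_self u)] at h'
    refine H1t.fn_injective (eq_zero_of_D_ae (n := 2) (by norm_num) u.mem.1 u.mem.2.1 ?_)
    filter_upwards [h', ae_restrict_mem measurableSet_Ioc] with ρ h1 h2
    have : ρ ≠ 0 := h2.1.ne'
    simpa [this] using h1

/-- The inner product `(u|v)₂ = ∫₀¹ u' v̄' dρ` on `H̃₂`; following Mathlib's convention it is
conjugate linear in its first argument, so that `inner u v` is `(v|u)₂`. -/
@[reducible] noncomputable def core2 : InnerProductSpace.Core ℂ H2t where
  inner u v := ∫ ρ in (0 : ℝ)..1, conj (D u.fn ρ) * D v.fn ρ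
  conj_inner_symm u v := by
    simp only [intervalIntegral.integral_of_le zero_le_one]
    rw [← integral_conj]
    congr 1; funext ρ
    simp [mul_comm]
  re_inner_nonneg u := by
    rw [self2]
    exact intervalIntegral.integral_nonneg zero_le_one fun ρ _ => by positivity
  add_left u v w := by
    rw [← intervalIntegral.integral_add (integrable2 u w) (integrable2 v w)]
    refine intervalIntegral.integral_congr fun ρ hρ => ?_
    rw [uIcc_of_le zero_le_one] at hρ
    simp only [map_add]
    rw [D_add (n := 1) (by norm_num) u.mem.1.1 v.mem.1.1 hρ, map_add]
    ring
  smul_left u v c := by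
    rw [← intervalIntegral.integral_const_mul]
    refine intervalIntegral.integral_congr fun ρ hρ => ?_
    rw [uIcc_of_le zero_le_one] at hρ
    simp only [map_smul]
    rw [D_smul (n := 1) (by norm_num) c u.mem.1.1 hρ, map_mul]
    ring
  definite u h := by
    rw [self2] at h
    have h' := Complex.ofReal_eq_zero.1 h
    rw [intervalIntegral.integral_eq_zero_iff_of_le_of_nonneg_ae zero_le_one
      (ae_of_all _ fun ρ => by positivity) (integrable2_self u)] at h'
    refine H2t.fn_injective (eq_zero_of_D_ae (n := 1) (by norm_num) u.mem.1 u.mem.2 ?_)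
    filter_upwards [h'] with ρ h1
    simpa using h1

noncomputable instance : NormedAddCommGroup H1t := core1.toNormedAddCommGroup
noncomputable instance : InnerProductSpace ℂ H1t := InnerProductSpace.ofCore core1.toCore
noncomputable instance : NormedAddCommGroup H2t := core2.toNormedAddCommGroup
noncomputable instance : InnerProductSpace ℂ H2t := InnerProductSpace.ofCore core2.toCore

/-- The pre-Hilbert space `H̃ = H̃₁ × H̃₂` with the inner product `(u₁|v₁)₁ + (u₂|v₂)₂`. -/
abbrev Ht : Type := WithLp 2 (H1t × H2t)

/-- The Hilbert space `H = H₁ × H₂`, the completion of `H̃`. -/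
noncomputable abbrev H : Type := UniformSpace.Completion Ht


/-- The potential `V₁(ρ) = -16 / (1 + ρ²)²`. -/
noncomputable def V₁ (ρ : ℝ) : ℝ := -16 / (1 + ρ ^ 2) ^ 2

/-- `V₁(ρ) = (2 cos(2 f₀(ρ)) - 2) / ρ²`, where `f₀(ρ) = 2 arctan ρ` is the ground state. -/
theorem V₁_eq {ρ : ℝ} (hρ : ρ ≠ 0) :
    V₁ ρ = (2 * Real.cos (2 * (2 * Real.arctan ρ)) - 2) / ρ ^ 2 := by
  have h : (1 + ρ ^ 2) ≠ 0 := by positivity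
  rw [V₁, Real.cos_two_mul, Real.cos_two_mul, Real.cos_sq_arctan]
  field_simp
  ring

/-- `(K u)(ρ) = ∫₀^ρ ρ' u(ρ') dρ'`. -/
noncomputable def K (u : ℝ → ℂ) (ρ : ℝ) : ℂ := ∫ r in (0 : ℝ)..ρ, (r : ℂ) * u r

/-- The first component of the differential expression `L̃₀ u`. -/
noncomputable def l01 (u₁ u₂ : ℝ → ℂ) : ℝ → ℂ :=
  I.indicator fun ρ => -ρ * D u₁ ρ + u₁ ρ + ρ * D u₂ ρ - u₂ ρ

/-- The second component of the differential expression `L̃₀ u`. On the domain below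
`u₁'(ρ) / ρ → u₁''(0) = 0` as `ρ → 0`, which agrees with the value of the quotient at `ρ = 0`. -/
noncomputable def l02 (u₁ u₂ : ℝ → ℂ) : ℝ → ℂ :=
  I.indicator fun ρ => D u₁ ρ / ρ - ρ * D u₂ ρ

/-- The first component `-V₁(ρ) ∫₀^ρ ρ' u₂(ρ') dρ'` of `L' u`. -/
noncomputable def lp1 (u₂ : ℝ → ℂ) : ℝ → ℂ :=
  I.indicator fun ρ => -V₁ ρ * K u₂ ρ

theorem mem_Ck_indicator {k : ℕ} {f : ℝ → ℂ} (hf : ContDiffOn ℝ k f I) :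
    I.indicator f ∈ Ck k :=
  ⟨hf.congr fun _ hx => indicator_of_mem hx f, fun _ hx => indicator_of_notMem hx f⟩

theorem D_indicator {f : ℝ → ℂ} {ρ : ℝ} (hρ : ρ ∈ I) : D (I.indicator f) ρ = D f ρ :=
  D_congr (fun _ hx => indicator_of_mem hx f) hρ

theorem contDiffOn_id' {n : ℕ} : ContDiffOn ℝ n (fun ρ : ℝ => (ρ : ℂ)) I :=
  Complex.ofRealCLM.contDiff.contDiffOn

theorem hasD_id {ρ : ℝ} : HasDerivWithinAt (fun ρ : ℝ => (ρ : ℂ)) 1 I ρ :=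
  Complex.ofRealCLM.hasDerivAt.hasDerivWithinAt

theorem l01_mem {u₁ u₂ : ℝ → ℂ} (h1 : u₁ ∈ Ck 3) (h10 : u₁ 0 = 0) (h2 : u₂ ∈ Ck 3)
    (h20 : u₂ 0 = 0) : l01 u₁ u₂ ∈ preH1 := by
  refine ⟨mem_Ck_indicator ?_, ?_, ?_⟩
  · have a1 := contDiffOn_D h1.1 (m := 2) (by norm_num)
    have a2 := contDiffOn_D h2.1 (m := 2) (by norm_num)
    have b1 := h1.1.of_le (m := (2 : ℕ)) (by norm_cast)
    have b2 := h2.1.of_le (m := (2 : ℕ)) (by norm_cast)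
    exact (((contDiffOn_id'.neg.mul a1).add b1).add (contDiffOn_id'.mul a2)).sub b2
  · simp [l01, h10, h20]
  · rw [l01, D_indicator zero_mem_I]
    have a1 := hasD (contDiffOn_D h1.1 (m := 2) (by norm_num)) (by norm_num) zero_mem_I
    have a2 := hasD (contDiffOn_D h2.1 (m := 2) (by norm_num)) (by norm_num) zero_mem_I
    have b1 := hasD h1.1 (by norm_num) zero_mem_I
    have b2 := hasD h2.1 (by norm_num) zero_mem_I
    refine D_eq zero_mem_I
      (((((hasD_id (ρ := 0)).neg.mul a1).add b1).add (hasD_id.mul a2)).sub b2 |>.congr_deriv ?_)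
    simp

/-- If `g ∈ C²[0,1]` and `g(0) = g'(0) = 0`, then `g(ρ)/ρ` is in `C¹[0,1]`. -/
theorem contDiffOn_div {g : ℝ → ℂ} (hg : ContDiffOn ℝ (2 : ℕ) g I) (h0 : g 0 = 0)
    (h1 : D g 0 = 0) : ContDiffOn ℝ (1 : ℕ) (fun ρ : ℝ => g ρ / ρ) I := by
  have hDg := contDiffOn_D hg (m := 1) (by norm_num)
  have hDDc : ContinuousOn (D (D g)) I := (contDiffOn_D hDg (m := 0) (by norm_num)).continuousOn
  set c : ℂ := D (D g) 0 with hc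
  set k : ℝ → ℂ := fun ρ => if ρ = 0 then c / 2 else (D g ρ * ρ - g ρ * 1) / (ρ : ℂ) ^ 2 with hk
  have key : ∀ ε > 0, ∃ δ > 0, ∀ ρ ∈ I, ρ < δ →
      ‖D g ρ - c * ρ‖ ≤ ε * ρ ∧ ‖g ρ - c * (ρ : ℂ) ^ 2 / 2‖ ≤ ε * ρ ^ 2 := by
    intro ε hε
    have h2 := (hasD hDg le_rfl zero_mem_I).isLittleO.def hε
    obtain ⟨δ, hδ, hb⟩ := Metric.mem_nhdsWithin_iff.1 h2
    have hb' : ∀ ρ ∈ I, ρ < δ → ‖D g ρ - c * ρ‖ ≤ ε * ρ := by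
      intro ρ hρ hlt
      have := hb ⟨by simpa [abs_of_nonneg hρ.1] using hlt, hρ⟩
      simpa [h1, abs_of_nonneg hρ.1, mul_comm] using this
    refine ⟨δ, hδ, fun ρ hρ hlt => ⟨hb' ρ hρ hlt, ?_⟩⟩
    have hsub : Icc 0 ρ ⊆ I := Icc_subset_Icc_right hρ.2
    have hder : ∀ x ∈ Icc 0 ρ,
        HasDerivWithinAt (fun x : ℝ => g x - c * (x : ℂ) ^ 2 / 2) (D g x - c * x) (Icc 0 ρ) x := by
      intro x hx
      have e1 := (hasD hg (by norm_num) (hsub hx)).mono hsub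
      have e2 := (((hasD_id (ρ := x)).mono hsub).pow 2).const_mul c |>.div_const 2
      refine (e1.sub e2).congr_deriv ?_
      push_cast
      ring
    have hbd : ∀ x ∈ Icc 0 ρ, ‖D g x - c * x‖ ≤ ε * ρ := fun x hx =>
      (hb' x (hsub hx) (hx.2.trans_lt hlt)).trans (by gcongr; exact hx.2)
    have := (convex_Icc (0 : ℝ) ρ).norm_image_sub_le_of_norm_hasDerivWithin_le hder hbd
      (left_mem_Icc.2 hρ.1) (right_mem_Icc.2 hρ.1)
    simp only [h0, Complex.ofReal_zero, sub_zero, Real.norm_eq_abs, abs_of_nonneg hρ.1] at this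
    calc _ ≤ _ := by simpa using this
      _ = _ := by ring
  have hder : ∀ ρ ∈ I, HasDerivWithinAt (fun ρ : ℝ => g ρ / ρ) (k ρ) I ρ := by
    intro ρ hρ
    by_cases h : ρ = 0
    · subst h
      rw [hasDerivWithinAt_iff_isLittleO, Asymptotics.isLittleO_iff]
      intro ε hε
      obtain ⟨δ, hδ, hb⟩ := key ε hε
      refine Metric.mem_nhdsWithin_iff.2 ⟨δ, hδ, ?_⟩
      rintro x ⟨hx1, hx⟩
      have hlt : x < δ := by simpa [abs_of_nonneg hx.1] using hx1
      rcases hx.1.eq_or_lt with h | h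
      · simp [← h]
      have hx0 : (x : ℂ) ≠ 0 := by exact_mod_cast h.ne'
      have e : g x / x - g 0 / ((0 : ℝ) : ℂ) - (x - 0) • k 0 =
          (g x - c * (x : ℂ) ^ 2 / 2) / x := by
        simp only [hk, if_true, h0, Complex.real_smul]
        push_cast
        field_simp
        ring
      simp only [mem_ofPred_eq]
      rw [e, norm_div, Complex.norm_real, Real.norm_eq_abs, abs_of_pos h, div_le_iff₀ h, sub_zero,
        Real.norm_eq_abs, abs_of_pos h]
      exact ((hb x hx hlt).2).trans_eq (by ring)
    · have hx0 : (ρ : ℂ) ≠ 0 := by exact_mod_cast h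
      have := (hasD hg (by norm_num) hρ).div hasD_id hx0
      simp only [hk, h, if_false]
      exact this
  have hkc : ContinuousOn k I := by
    intro ρ hρ
    by_cases h : ρ = 0
    · subst h
      rw [Metric.continuousWithinAt_iff]
      intro ε hε
      obtain ⟨δ, hδ, hb⟩ := key (ε / 3) (by positivity)
      refine ⟨δ, hδ, fun {x} hx hx1 => ?_⟩
      have hlt : x < δ := by simpa [abs_of_nonneg hx.1] using hx1
      rcases hx.1.eq_or_lt with h | h
      · simpa [← h] using hε
      have hx0 : (x : ℂ) ≠ 0 := by exact_mod_cast h.ne'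
      have e : k x - k 0 =
          ((D g x - c * x) * x - (g x - c * (x : ℂ) ^ 2 / 2)) / (x : ℂ) ^ 2 := by
        simp only [hk, if_true, h.ne', if_false]
        field_simp
        ring
      rw [dist_eq_norm, e, norm_div, norm_pow, Complex.norm_real, Real.norm_eq_abs,
        abs_of_pos h, div_lt_iff₀ (by positivity)]
      obtain ⟨b1, b2⟩ := hb x hx hlt
      calc _ ≤ ‖D g x - c * x‖ * x + ‖g x - c * (x : ℂ) ^ 2 / 2‖ := by
            refine (norm_sub_le _ _).trans_eq ?_
            rw [norm_mul, Complex.norm_real, Real.norm_eq_abs, abs_of_pos h]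
        _ ≤ ε / 3 * x * x + ε / 3 * x ^ 2 := by gcongr
        _ < ε * x ^ 2 := by nlinarith [mul_pos hε (pow_pos h 2)]
    · have hx0 : (ρ : ℂ) ≠ 0 := by exact_mod_cast h
      have hcont : ContinuousWithinAt
          (fun ρ : ℝ => (D g ρ * ρ - g ρ * 1) / (ρ : ℂ) ^ 2) I ρ := by
        refine ContinuousWithinAt.div ?_ (by fun_prop) (pow_ne_zero 2 hx0)
        exact ((hDg.continuousOn ρ hρ).mul
          Complex.continuous_ofReal.continuousWithinAt).sub ((hg.continuousOn ρ hρ).mul_const 1)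
      refine hcont.congr_of_eventuallyEq ?_ (by simp [hk, h])
      filter_upwards [mem_nhdsWithin_of_mem_nhds (isOpen_ne.mem_nhds h)] with x hx
      have hx' : x ≠ 0 := hx
      simp [hk, hx']
  rw [show ((1 : ℕ) : WithTop ℕ∞) = 1 by norm_num, contDiffOn_one_iff_derivWithin uniqueDiff]
  exact ⟨fun ρ hρ => (hder ρ hρ).differentiableWithinAt,
    hkc.congr fun ρ hρ => D_eq hρ (hder ρ hρ)⟩

theorem l02_mem {u₁ u₂ : ℝ → ℂ} (h1 : u₁ ∈ Ck 3) (h1' : D u₁ 0 = 0)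
    (h1'' : D (D u₁) 0 = 0) (h2 : u₂ ∈ Ck 3) : l02 u₁ u₂ ∈ preH2 := by
  refine ⟨mem_Ck_indicator ?_, ?_⟩
  · exact (contDiffOn_div (contDiffOn_D h1.1 (m := 2) (by norm_num)) h1' h1'').sub
      (contDiffOn_id'.mul (contDiffOn_D h2.1 (m := 1) (by norm_num)))
  · simp [l02, h1']

theorem hasD_K {u : ℝ → ℂ} (hu : ContinuousOn u I) {ρ : ℝ} (hρ : ρ ∈ I) :
    HasDerivWithinAt (K u) (ρ * u ρ) I ρ := by
  have hc : ContinuousOn (fun r : ℝ => (r : ℂ) * u r) I :=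
    Complex.continuous_ofReal.continuousOn.mul hu
  have : Fact (ρ ∈ Icc (0 : ℝ) 1) := ⟨hρ⟩
  exact intervalIntegral.integral_hasDerivWithinAt_right
    ((hc.mono (Icc_subset_Icc_right hρ.2)).intervalIntegrable_of_Icc hρ.1)
    (hc.stronglyMeasurableAtFilter_nhdsWithin measurableSet_Icc ρ) (hc ρ hρ)

theorem contDiffOn_K {u : ℝ → ℂ} (hu : ContDiffOn ℝ (1 : ℕ) u I) :
    ContDiffOn ℝ (2 : ℕ) (K u) I := by
  have h := fun ρ (hρ : ρ ∈ I) => hasD_K hu.continuousOn hρ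
  rw [show ((2 : ℕ) : WithTop ℕ∞) = ((1 : ℕ) : WithTop ℕ∞) + 1 by norm_num,
    contDiffOn_succ_iff_derivWithin uniqueDiff]
  refine ⟨fun ρ hρ => (h ρ hρ).differentiableWithinAt, by simp, ?_⟩
  exact (contDiffOn_id'.mul hu).congr fun ρ hρ => D_eq hρ (h ρ hρ)

theorem contDiff_V₁_real {n : ℕ} : ContDiff ℝ n V₁ :=
  contDiff_const.div (by fun_prop) fun x => by positivity

theorem contDiff_V₁ {n : ℕ} : ContDiff ℝ n (fun ρ => ((V₁ ρ : ℝ) : ℂ)) := by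
  exact Complex.ofRealCLM.contDiff.comp contDiff_V₁_real

theorem lp1_hasD {u : ℝ → ℂ} (hu : ContinuousOn u I) {ρ : ℝ} (hρ : ρ ∈ I) :
    D (lp1 u) ρ = -((deriv V₁ ρ : ℝ) : ℂ) * K u ρ + -V₁ ρ * (ρ * u ρ) := by
  rw [lp1, D_indicator hρ]
  have h1 : HasDerivAt V₁ (deriv V₁ ρ) ρ :=
    ((contDiff_V₁_real (n := 1)).differentiable (by norm_num) ρ).hasDerivAt
  exact D_eq hρ (h1.ofReal_comp.neg.hasDerivWithinAt.mul (hasD_K hu hρ))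

theorem lp1_mem {u : ℝ → ℂ} (hu : u ∈ preH2) : lp1 u ∈ preH1 := by
  refine ⟨mem_Ck_indicator ?_, ?_, ?_⟩
  · exact contDiff_V₁.contDiffOn.neg.mul (contDiffOn_K hu.1.1)
  · simp [lp1, K]
  · rw [lp1_hasD hu.1.1.continuousOn zero_mem_I]
    simp [K]

/-- The domain `{u ∈ C³[0,1] : u(0) = u'(0) = u''(0) = 0} × {u ∈ C³[0,1] : u(0) = 0}` of `L̃₀`,
as a subspace of `H̃`. -/
noncomputable def domL0t : Submodule ℂ Ht where
  carrier := {u | (u.fst.fn ∈ Ck 3 ∧ u.fst.fn 0 = 0 ∧ D u.fst.fn 0 = 0 ∧ D (D u.fst.fn) 0 = 0) ∧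
    u.snd.fn ∈ Ck 3 ∧ u.snd.fn 0 = 0}
  add_mem' := by
    rintro u v ⟨⟨a1, a2, a3, a4⟩, a5, a6⟩ ⟨⟨b1, b2, b3, b4⟩, b5, b6⟩
    refine ⟨⟨?_, ?_, ?_, ?_⟩, ?_, ?_⟩
    · simpa using add_mem a1 b1
    · simp [a2, b2]
    · simp only [WithLp.add_fst, map_add]
      rw [D_add (by norm_num) a1.1 b1.1 zero_mem_I, a3, b3, add_zero]
    · simp only [WithLp.add_fst, map_add]
      rw [D_congr (fun ρ hρ => D_add (by norm_num) a1.1 b1.1 hρ) zero_mem_I]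
      exact (D_add (n := 2) (by norm_num) (contDiffOn_D a1.1 (by norm_num))
        (contDiffOn_D b1.1 (by norm_num)) zero_mem_I).trans (by rw [a4, b4, add_zero])
    · simpa using add_mem a5 b5
    · simp [a6, b6]
  zero_mem' := by
    have h : D (0 : ℝ → ℂ) = 0 := by funext x; simp [D]
    simp [h]
  smul_mem' := by
    rintro c u ⟨⟨a1, a2, a3, a4⟩, a5, a6⟩
    refine ⟨⟨?_, ?_, ?_, ?_⟩, ?_, ?_⟩
    · simpa using Submodule.smul_mem _ c a1
    · simp [a2]
    · simp only [WithLp.smul_fst, map_smul]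
      rw [D_smul (by norm_num) c a1.1 zero_mem_I, a3, mul_zero]
    · simp only [WithLp.smul_fst, map_smul]
      rw [D_congr (v := c • D u.fst.fn) (fun ρ hρ => D_smul (by norm_num) c a1.1 hρ) zero_mem_I]
      rw [D_smul (n := 2) (by norm_num) c (contDiffOn_D a1.1 (by norm_num)) zero_mem_I, a4,
        mul_zero]
    · simpa using Submodule.smul_mem _ c a5
    · simp [a6]

theorem l01_add {u₁ u₂ v₁ v₂ : ℝ → ℂ} (h1 : u₁ ∈ Ck 3) (h2 : u₂ ∈ Ck 3) (k1 : v₁ ∈ Ck 3)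
    (k2 : v₂ ∈ Ck 3) : l01 (u₁ + v₁) (u₂ + v₂) = l01 u₁ u₂ + l01 v₁ v₂ := by
  funext ρ
  by_cases hρ : ρ ∈ I
  · simp only [l01, Pi.add_apply, indicator_of_mem hρ]
    rw [D_add (by norm_num) h1.1 k1.1 hρ, D_add (by norm_num) h2.1 k2.1 hρ]
    ring
  · simp [l01, indicator_of_notMem hρ]

theorem l02_add {u₁ u₂ v₁ v₂ : ℝ → ℂ} (h1 : u₁ ∈ Ck 3) (h2 : u₂ ∈ Ck 3) (k1 : v₁ ∈ Ck 3)
    (k2 : v₂ ∈ Ck 3) : l02 (u₁ + v₁) (u₂ + v₂) = l02 u₁ u₂ + l02 v₁ v₂ := by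
  funext ρ
  by_cases hρ : ρ ∈ I
  · simp only [l02, Pi.add_apply, indicator_of_mem hρ]
    rw [D_add (by norm_num) h1.1 k1.1 hρ, D_add (by norm_num) h2.1 k2.1 hρ]
    ring
  · simp [l02, indicator_of_notMem hρ]

theorem l01_smul (c : ℂ) {u₁ u₂ : ℝ → ℂ} (h1 : u₁ ∈ Ck 3) (h2 : u₂ ∈ Ck 3) :
    l01 (c • u₁) (c • u₂) = c • l01 u₁ u₂ := by
  funext ρ
  by_cases hρ : ρ ∈ I
  · simp only [l01, Pi.smul_apply, indicator_of_mem hρ, smul_eq_mul]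
    rw [D_smul (by norm_num) c h1.1 hρ, D_smul (by norm_num) c h2.1 hρ]
    ring
  · simp [l01, indicator_of_notMem hρ]

theorem l02_smul (c : ℂ) {u₁ u₂ : ℝ → ℂ} (h1 : u₁ ∈ Ck 3) (h2 : u₂ ∈ Ck 3) :
    l02 (c • u₁) (c • u₂) = c • l02 u₁ u₂ := by
  funext ρ
  by_cases hρ : ρ ∈ I
  · simp only [l02, Pi.smul_apply, indicator_of_mem hρ, smul_eq_mul]
    rw [D_smul (by norm_num) c h1.1 hρ, D_smul (by norm_num) c h2.1 hρ]
    ring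
  · simp [l02, indicator_of_notMem hρ]

theorem intervalIntegrable_K {u : ℝ → ℂ} (hu : ContinuousOn u I) {ρ : ℝ} (hρ : ρ ∈ I) :
    IntervalIntegrable (fun r : ℝ => (r : ℂ) * u r) volume 0 ρ :=
  ((Complex.continuous_ofReal.continuousOn.mul hu).mono
    (Icc_subset_Icc_right hρ.2)).intervalIntegrable_of_Icc hρ.1

theorem lp1_add {u v : ℝ → ℂ} (hu : u ∈ preH2) (hv : v ∈ preH2) :
    lp1 (u + v) = lp1 u + lp1 v := by
  funext ρ
  by_cases hρ : ρ ∈ I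
  · have h : K (u + v) ρ = K u ρ + K v ρ := by
      simp only [K, Pi.add_apply, mul_add]
      exact intervalIntegral.integral_add (intervalIntegrable_K hu.1.1.continuousOn hρ)
        (intervalIntegrable_K hv.1.1.continuousOn hρ)
    simp only [lp1, Pi.add_apply, indicator_of_mem hρ]
    rw [h]
    ring
  · simp [lp1, indicator_of_notMem hρ]

theorem lp1_smul (c : ℂ) (u : ℝ → ℂ) : lp1 (c • u) = c • lp1 u := by
  have h : ∀ ρ, K (c • u) ρ = c * K u ρ := fun ρ => by
    simp only [K, Pi.smul_apply, smul_eq_mul, mul_left_comm _ c]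
    exact intervalIntegral.integral_const_mul _ _
  funext ρ
  by_cases hρ : ρ ∈ I
  · simp only [lp1, Pi.smul_apply, indicator_of_mem hρ, smul_eq_mul]
    rw [h]
    ring
  · simp [lp1, indicator_of_notMem hρ]

/-- A function of `H̃₁`. -/
def H1t.mk (u : ℝ → ℂ) (hu : u ∈ preH1) : H1t := ⟨u, hu⟩

/-- A function of `H̃₂`. -/
def H2t.mk (u : ℝ → ℂ) (hu : u ∈ preH2) : H2t := ⟨u, hu⟩

@[simp] theorem H1t.fn_mk (u : ℝ → ℂ) (hu : u ∈ preH1) : (H1t.mk u hu).fn = u := rfl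

@[simp] theorem H2t.fn_mk (u : ℝ → ℂ) (hu : u ∈ preH2) : (H2t.mk u hu).fn = u := rfl

theorem Ht_ext {u v : Ht} (h1 : u.fst.fn = v.fst.fn) (h2 : u.snd.fn = v.snd.fn) : u = v :=
  WithLp.ofLp_injective 2 (Prod.ext (H1t.fn_injective h1) (H2t.fn_injective h2))

/-- The operator `L̃₀` as a map from its domain to `H̃`. -/
noncomputable def L0fun : domL0t →ₗ[ℂ] Ht where
  toFun u := WithLp.toLp 2
    (H1t.mk (l01 u.1.fst.fn u.1.snd.fn) (l01_mem u.2.1.1 u.2.1.2.1 u.2.2.1 u.2.2.2),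
     H2t.mk (l02 u.1.fst.fn u.1.snd.fn) (l02_mem u.2.1.1 u.2.1.2.2.1 u.2.1.2.2.2 u.2.2.1))
  map_add' u v := Ht_ext (by simpa using l01_add u.2.1.1 u.2.2.1 v.2.1.1 v.2.2.1)
    (by simpa using l02_add u.2.1.1 u.2.2.1 v.2.1.1 v.2.2.1)
  map_smul' c u := Ht_ext (by simpa using l01_smul c u.2.1.1 u.2.2.1)
    (by simpa using l02_smul c u.2.1.1 u.2.2.1)

/-- The dense isometric embedding of `H̃` into its completion. -/
noncomputable abbrev emb : Ht →L[ℂ] H := UniformSpace.Completion.toComplL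

theorem emb_injective : Function.Injective (emb : Ht →ₗ[ℂ] H) :=
  UniformSpace.Completion.coe_injective Ht

/-- `L̃₀` as an unbounded operator in the Hilbert space `H`: its domain is the image of the above
domain under the embedding, and there it maps `emb u` to `emb (L̃₀ u)`. -/
noncomputable def L0t : H →ₗ.[ℂ] H where
  domain := domL0t.map (emb : Ht →ₗ[ℂ] H)
  toFun := (emb : Ht →ₗ[ℂ] H) ∘ₗ L0fun ∘ₗ
    ((Submodule.equivMapOfInjective (emb : Ht →ₗ[ℂ] H) emb_injective domL0t).symm :
      domL0t.map (emb : Ht →ₗ[ℂ] H) →ₗ[ℂ] domL0t)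

theorem L0t_apply (u : domL0t) : L0t ⟨emb u.1, Submodule.mem_map_of_mem u.2⟩ = emb (L0fun u) := by
  exact congrArg (fun x => emb (L0fun x)) ((Submodule.equivMapOfInjective
    (emb : Ht →ₗ[ℂ] H) emb_injective domL0t).symm_apply_apply u)

/-- The free operator `L₀`, the closure of `L̃₀`. -/
noncomputable def L0 : H →ₗ.[ℂ] H := L0t.closure

/-- The operator `L'` on `H̃`. -/
noncomputable def LpFun : Ht →ₗ[ℂ] Ht where
  toFun u := WithLp.toLp 2 (H1t.mk (lp1 u.snd.fn) (lp1_mem u.snd.mem), 0)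
  map_add' u v := Ht_ext (by simpa using lp1_add u.snd.mem v.snd.mem) (by simp)
  map_smul' c u := Ht_ext (by simpa using lp1_smul c u.snd.fn) (by simp)

theorem norm_sq1 (u : H1t) : ‖u‖ ^ 2 = ∫ ρ in (0 : ℝ)..1, ‖D u.fn ρ‖ ^ 2 / ρ ^ 2 := by
  rw [← inner_self_eq_norm_sq (𝕜 := ℂ)]
  exact (congrArg Complex.re (self1 u)).trans (Complex.ofReal_re _)

theorem norm_sq2 (u : H2t) : ‖u‖ ^ 2 = ∫ ρ in (0 : ℝ)..1, ‖D u.fn ρ‖ ^ 2 := by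
  rw [← inner_self_eq_norm_sq (𝕜 := ℂ)]
  exact (congrArg Complex.re (self2 u)).trans (Complex.ofReal_re _)

theorem norm_le2 (u : H2t) {ρ : ℝ} (hρ : ρ ∈ I) : ‖u.fn ρ‖ ≤ ‖u‖ := by
  have hsub : Icc 0 ρ ⊆ I := Icc_subset_Icc_right hρ.2
  have hn : IntervalIntegrable (fun x => ‖D u.fn x‖) volume 0 1 :=
    (contOn_D2 u).norm.intervalIntegrable_of_Icc zero_le_one
  have h1 : ∫ x in (0 : ℝ)..ρ, D u.fn x = u.fn ρ - u.fn 0 := by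
    refine intervalIntegral.integral_eq_sub_of_hasDerivAt_of_le hρ.1
      (u.mem.1.1.continuousOn.mono hsub) (fun x hx => ?_)
      (((contOn_D2 u).mono hsub).intervalIntegrable_of_Icc hρ.1)
    have hx' : x ∈ Ioo (0 : ℝ) 1 := ⟨hx.1, hx.2.trans_le hρ.2⟩
    exact (hasD u.mem.1.1 le_rfl (Ioo_subset_Icc_self hx')).hasDerivAt (Icc_mem_nhds hx'.1 hx'.2)
  rw [u.mem.2, sub_zero] at h1
  set m := ∫ x in (0 : ℝ)..1, ‖D u.fn x‖ with hm
  have h2 : ‖u.fn ρ‖ ≤ m := by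
    rw [← h1]
    exact (intervalIntegral.norm_integral_le_integral_norm hρ.1).trans
      (intervalIntegral.integral_mono_interval le_rfl hρ.1 hρ.2
        (ae_of_all _ fun x => norm_nonneg _) hn)
  have h3 : m ^ 2 ≤ ‖u‖ ^ 2 := by
    have h4 : 0 ≤ ∫ x in (0 : ℝ)..1, (‖D u.fn x‖ - m) ^ 2 :=
      intervalIntegral.integral_nonneg zero_le_one fun x _ => sq_nonneg _
    have h5 : ∫ x in (0 : ℝ)..1, (‖D u.fn x‖ - m) ^ 2 = ‖u‖ ^ 2 - m ^ 2 := by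
      have : ∀ x, (‖D u.fn x‖ - m) ^ 2 = ‖D u.fn x‖ ^ 2 - (2 * m * ‖D u.fn x‖ - m ^ 2) :=
        fun x => by ring
      simp only [this]
      rw [intervalIntegral.integral_sub (integrable2_self u) ((hn.const_mul _).sub (by simp)),
        intervalIntegral.integral_sub (hn.const_mul _) (by simp),
        intervalIntegral.integral_const_mul, ← hm, ← norm_sq2]
      simp
      ring
    linarith
  exact h2.trans (abs_le_of_sq_le_sq' h3 (norm_nonneg _)).2

theorem norm_K_le (u : H2t) {ρ : ℝ} (hρ : ρ ∈ I) : ‖K u.fn ρ‖ ≤ ‖u‖ * ρ := by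
  have := intervalIntegral.norm_integral_le_of_norm_le_const (a := 0) (b := ρ) (C := ‖u‖)
    (f := fun r : ℝ => (r : ℂ) * u.fn r) ?_
  · simpa [K, abs_of_nonneg hρ.1] using this
  · intro x hx
    rw [uIoc_of_le hρ.1] at hx
    have hx' : x ∈ I := ⟨hx.1.le, hx.2.trans hρ.2⟩
    rw [norm_mul, Complex.norm_real, Real.norm_eq_abs, abs_of_nonneg hx'.1]
    calc x * ‖u.fn x‖ ≤ 1 * ‖u‖ := by
          gcongr
          · exact hx'.2
          · exact norm_le2 u hx'
      _ = ‖u‖ := one_mul _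

theorem LpFun_bounded : ∃ C : ℝ, ∀ u, ‖LpFun u‖ ≤ C * ‖u‖ := by
  obtain ⟨A, hA⟩ := (isCompact_Icc (a := (0 : ℝ)) (b := 1)).exists_bound_of_continuousOn
    ((contDiff_V₁_real (n := 1)).continuous_deriv (by norm_num)).continuousOn
  obtain ⟨B, hB⟩ := (isCompact_Icc (a := (0 : ℝ)) (b := 1)).exists_bound_of_continuousOn
    (contDiff_V₁_real (n := 1)).continuous.continuousOn
  have hA0 : 0 ≤ A := (norm_nonneg _).trans (hA 0 zero_mem_I)
  have hB0 : 0 ≤ B := (norm_nonneg _).trans (hB 0 zero_mem_I)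
  refine ⟨A + B, fun u => ?_⟩
  set w : H1t := H1t.mk (lp1 u.snd.fn) (lp1_mem u.snd.mem) with hw
  have hu : ‖u.snd‖ ≤ ‖u‖ := by
    have := WithLp.prod_norm_sq_eq_of_L2 u
    exact (abs_le_of_sq_le_sq' (by nlinarith [sq_nonneg ‖u.fst‖]) (norm_nonneg _)).2
  have h1 : ‖LpFun u‖ = ‖w‖ := by
    have := WithLp.prod_norm_sq_eq_of_L2 (LpFun u)
    have e : ‖LpFun u‖ ^ 2 = ‖w‖ ^ 2 := by
      rw [this]; simp [LpFun, hw]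
    exact (sq_eq_sq₀ (norm_nonneg _) (norm_nonneg _)).1 e
  have h2 : ‖w‖ ^ 2 ≤ ((A + B) * ‖u.snd‖) ^ 2 := by
    rw [norm_sq1]
    calc _ ≤ ∫ _ in (0 : ℝ)..1, ((A + B) * ‖u.snd‖) ^ 2 := by
          refine intervalIntegral.integral_mono_on zero_le_one (integrable1_self w) (by simp) ?_
          intro x hx
          rcases hx.1.eq_or_lt with h | h
          · rw [← h]; simp; positivity
          rw [div_le_iff₀ (by positivity), ← mul_pow]
          refine pow_le_pow_left₀ (norm_nonneg _) ?_ 2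
          rw [hw, H1t.fn_mk, lp1_hasD u.snd.mem.1.1.continuousOn hx]
          refine (norm_add_le _ _).trans ?_
          simp only [norm_mul, norm_neg, Complex.norm_real]
          have k1 := norm_K_le u.snd hx
          have k2 := norm_le2 u.snd hx
          have k3 := hA x hx
          have k4 := hB x hx
          calc _ ≤ A * (‖u.snd‖ * x) + B * (x * ‖u.snd‖) := by
                rw [Real.norm_eq_abs x, abs_of_pos h]
                gcongr
            _ = _ := by ring
      _ = _ := by simp
  rw [h1]
  calc ‖w‖ ≤ (A + B) * ‖u.snd‖ := (abs_le_of_sq_le_sq' h2 (by positivity)).2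
    _ ≤ (A + B) * ‖u‖ := by gcongr

/-- The bounded operator `L'` on `H`, the unique continuous extension. -/
noncomputable def Lp : H →L[ℂ] H :=
  (emb.comp (LpFun.mkContinuousOfExistsBound LpFun_bounded)).extend emb

theorem Lp_emb (u : Ht) : Lp (emb u) = emb (LpFun u) :=
  ContinuousLinearMap.extend_eq _ UniformSpace.Completion.denseRange_coe
    (UniformSpace.Completion.isUniformInducing_coe Ht) u

/-- The operator `L = L₀ + L'`, with the domain of `L₀`. -/
noncomputable def L : H →ₗ.[ℂ] H := (Lp : H →ₗ[ℂ] H) +ᵥ L0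

/-- `R` is the resolvent of the unbounded operator `A` at `z`: a bounded two-sided inverse of
`z - A : 𝒟(A) → E`. -/
def IsResolventAt {E : Type*} [NormedAddCommGroup E] [NormedSpace ℂ E] (A : E →ₗ.[ℂ] E) (z : ℂ)
    (R : E →L[ℂ] E) : Prop :=
  (∀ f : E, ∃ u : A.domain, (u : E) = R f ∧ z • (u : E) - A u = f) ∧
    ∀ u : A.domain, R (z • (u : E) - A u) = u

/-- The resolvent set `ρ(A)`. -/
def opResolventSet {E : Type*} [NormedAddCommGroup E] [NormedSpace ℂ E] (A : E →ₗ.[ℂ] E) : Set ℂ :=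
  {z | ∃ R : E →L[ℂ] E, IsResolventAt A z R}

/-- The spectrum `σ(A)`, the complement of the resolvent set. -/
def opSpectrum {E : Type*} [NormedAddCommGroup E] [NormedSpace ℂ E] (A : E →ₗ.[ℂ] E) : Set ℂ :=
  (opResolventSet A)ᶜ

/-- The point spectrum `σ_p(A)`, the set of all eigenvalues. -/
def opPointSpectrum {E : Type*} [NormedAddCommGroup E] [NormedSpace ℂ E] (A : E →ₗ.[ℂ] E) : Set ℂ :=
  {z | ∃ u : A.domain, (u : E) ≠ 0 ∧ A u = z • (u : E)}

open Classical in
/-- The resolvent `R_A(z) = (z - A)⁻¹` for `z ∈ ρ(A)` (and `0` for other `z`). -/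
noncomputable def opResolvent {E : Type*} [NormedAddCommGroup E] [NormedSpace ℂ E]
    (A : E →ₗ.[ℂ] E) (z : ℂ) : E →L[ℂ] E :=
  if h : z ∈ opResolventSet A then h.choose else 0

theorem IsResolventAt.unique {E : Type*} [NormedAddCommGroup E] [NormedSpace ℂ E]
    {A : E →ₗ.[ℂ] E} {z : ℂ} {R S : E →L[ℂ] E} (hR : IsResolventAt A z R)
    (hS : IsResolventAt A z S) : R = S := by
  ext f
  obtain ⟨u, hu, hf⟩ := hR.1 f
  rw [← hu, ← hS.2 u, hf]

theorem isResolventAt_opResolvent {E : Type*} [NormedAddCommGroup E] [NormedSpace ℂ E]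
    {A : E →ₗ.[ℂ] E} {z : ℂ} (h : z ∈ opResolventSet A) : IsResolventAt A z (opResolvent A z) := by
  rw [opResolvent, dif_pos h]
  exact h.choose_spec

end WaveMap

/-!
In the coordinates `a = u₁' / ρ` and `b = u₂'` the space `H` is an `L²` space and `L₀` is the
symmetric hyperbolic transport operator `(a, b) ↦ (-a - ρ a' + b', a' - b - ρ b')`. Integration by
parts gives `Re ⟪u, L̃₀ u⟫ ≤ -‖u‖² / 2`, and for polynomial data the Riemann invariants `a ± b`
solve `(z - L̃₀) u = f` explicitly, so the Lumer–Phillips argument gives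
`‖R_{L₀}(z)‖ ≤ (Re z + 1/2)⁻¹` for `Re z > -1/2`.

The operator `L'` only sees the `L²` norm of `u₂`, which the second row
`z u₂ = f₂ + u₁' / ρ - ρ u₂'` of the resolvent equation bounds by a multiple of
`(‖u‖ + ‖f‖) / |z|`. Hence `‖L' R_{L₀}(z)‖ = O(1 / |z|)`, and a Neumann series gives the resolvent
of `L` for large `|z|`.
-/

namespace WaveMap

section Operator

variable {𝕜 E F : Type*} [RCLike 𝕜]

section Closure

variable [NormedAddCommGroup E] [NormedSpace 𝕜 E] [NormedAddCommGroup F] [NormedSpace 𝕜 F]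

theorem topologicalClosure_graph_subset {T : E →ₗ.[𝕜] F} {s : Set (E × F)} (hs : IsClosed s)
    (h : ∀ u : T.domain, ((u : E), T u) ∈ s) : (T.graph.topologicalClosure : Set (E × F)) ⊆ s := by
  refine closure_minimal (fun p hp => ?_) hs
  obtain ⟨u, h₁, h₂⟩ := T.mem_graph_iff.1 hp
  simpa only [h₁, h₂] using h u

theorem closure_graph_mem_of_isClosed {T : E →ₗ.[𝕜] F} (hT : T.IsClosable) {s : Set (E × F)}
    (hs : IsClosed s) (h : ∀ u : T.domain, ((u : E), T u) ∈ s) (x : T.closure.domain) :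
    ((x : E), T.closure x) ∈ s := by
  refine topologicalClosure_graph_subset hs h ?_
  rw [hT.graph_closure_eq_closure_graph]
  exact T.closure.mem_graph x

theorem relative_bound_closure {T : E →ₗ.[𝕜] E} (hT : T.IsClosable) (B : E →L[𝕜] F) {z : 𝕜}
    {k C : ℝ}
    (h : ∀ u : T.domain, k * ‖B (u : E)‖ ≤ C * (‖(u : E)‖ + ‖z • (u : E) - T u‖))
    (x : T.closure.domain) : k * ‖B (x : E)‖ ≤ C * (‖(x : E)‖ + ‖z • (x : E) - T.closure x‖) :=
  closure_graph_mem_of_isClosed hT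
    (s := {p : E × E | k * ‖B p.1‖ ≤ C * (‖p.1‖ + ‖z • p.1 - p.2‖)})
    (isClosed_le (by fun_prop) (by fun_prop)) h x

end Closure

section Quasidissipative

variable [NormedAddCommGroup E] [InnerProductSpace 𝕜 E]

variable (𝕜) in
/-- The pairs `(x, y)` with `Re ⟪x, y⟫ ≤ ω ‖x‖²`, among which the graph of a quasidissipative
operator has to lie. -/
def quasidissipativeSet (E : Type*) [NormedAddCommGroup E] [InnerProductSpace 𝕜 E] (ω : ℝ) :
    Set (E × E) :=
  {p | RCLike.re ⟪p.1, p.2⟫_𝕜 ≤ ω * ‖p.1‖ ^ 2}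

/-- An operator `T` is quasidissipative with constant `ω` if `T - ω` is dissipative. -/
def IsQuasidissipative (T : E →ₗ.[𝕜] E) (ω : ℝ) : Prop :=
  ∀ u : T.domain, ((u : E), T u) ∈ quasidissipativeSet 𝕜 E ω

theorem isClosed_quasidissipativeSet (ω : ℝ) : IsClosed (quasidissipativeSet 𝕜 E ω) :=
  isClosed_le (RCLike.continuous_re.comp (continuous_fst.inner continuous_snd)) (by fun_prop)

theorem sub_mul_norm_le_norm_smul_sub {ω : ℝ} {x y : E} (h : (x, y) ∈ quasidissipativeSet 𝕜 E ω)
    (z : 𝕜) : (RCLike.re z - ω) * ‖x‖ ≤ ‖z • x - y‖ := by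
  rcases eq_or_ne x 0 with rfl | hx
  · simp
  refine le_of_mul_le_mul_left ?_ (norm_pos_iff.2 hx)
  calc ‖x‖ * ((RCLike.re z - ω) * ‖x‖) = RCLike.re z * ‖x‖ ^ 2 - ω * ‖x‖ ^ 2 := by ring
    _ ≤ RCLike.re z * ‖x‖ ^ 2 - RCLike.re ⟪x, y⟫_𝕜 := sub_le_sub_left h _
    _ = RCLike.re ⟪x, z • x - y⟫_𝕜 := by
      rw [inner_sub_right, inner_smul_right, inner_self_eq_norm_sq_to_K, map_sub,
        ← RCLike.ofReal_pow, RCLike.re_mul_ofReal]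
    _ ≤ ‖x‖ * ‖z • x - y‖ := re_inner_le_norm _ _

namespace IsQuasidissipative

variable {T : E →ₗ.[𝕜] E} {ω : ℝ}

theorem re_inner_eq_zero (hT : IsQuasidissipative T ω) {v : E}
    (hv : (0, v) ∈ T.graph.topologicalClosure) (u : T.domain) : RCLike.re ⟪(u : E), v⟫_𝕜 = 0 := by
  have quadratic_nonneg : ∀ t : ℝ, 0 ≤ (ω * ‖(u : E)‖ ^ 2 - RCLike.re ⟪(u : E), T u⟫_𝕜) * (t * t) +
      -RCLike.re ⟪(u : E), v⟫_𝕜 * t + 0 := fun t => by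
    have hmem := topologicalClosure_graph_subset (isClosed_quasidissipativeSet ω) hT
      (add_mem (Submodule.smul_mem _ (t : 𝕜) (T.graph.le_topologicalClosure (T.mem_graph u))) hv)
    simp only [quasidissipativeSet, mem_ofPred_eq, Prod.smul_mk, Prod.mk_add_mk, add_zero,
      inner_smul_left, inner_add_right, inner_smul_right, RCLike.conj_ofReal,
      RCLike.re_ofReal_mul, map_add, norm_smul, RCLike.norm_ofReal, mul_pow, sq_abs] at hmem
    linarith
  have := discrim_le_zero quadratic_nonneg
  rw [discrim, mul_zero, sub_zero] at this
  exact neg_eq_zero.1 (pow_eq_zero_iff two_ne_zero |>.1 (this.antisymm (sq_nonneg _)))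

theorem isClosable (hT : IsQuasidissipative T ω) (hdom : Dense (T.domain : Set E)) :
    T.IsClosable := by
  refine ⟨_, (Submodule.toLinearPMap_graph_eq T.graph.topologicalClosure ?_).symm⟩
  rintro ⟨_, v⟩ hv rfl
  have horth : (fun x => RCLike.re ⟪x, v⟫_𝕜) = fun _ => 0 :=
    (RCLike.continuous_re.comp (continuous_id.inner continuous_const)).ext_on hdom
      continuous_const fun x hx => hT.re_inner_eq_zero hv ⟨x, hx⟩
  exact re_inner_self_nonpos.1 (congrFun horth v).le

theorem closure (hT : IsQuasidissipative T ω) (hdom : Dense (T.domain : Set E)) :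
    IsQuasidissipative T.closure ω :=
  closure_graph_mem_of_isClosed (hT.isClosable hdom) (isClosed_quasidissipativeSet ω) hT

end IsQuasidissipative

end Quasidissipative

theorem exists_smul_sub_eq_of_denseRange [NormedAddCommGroup E] [NormedSpace 𝕜 E] [CompleteSpace E]
    {A : E →ₗ.[𝕜] E} (hA : A.IsClosed) {z : 𝕜} {c : ℝ} (hc : 0 < c)
    (hb : ∀ u : A.domain, c * ‖(u : E)‖ ≤ ‖z • (u : E) - A u‖)
    (hr : DenseRange fun u : A.domain => z • (u : E) - A u) (f : E) :
    ∃ u : A.domain, z • (u : E) - A u = f := by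
  let S : A.graph →L[𝕜] E :=
    (z • ContinuousLinearMap.fst 𝕜 E E - ContinuousLinearMap.snd 𝕜 E E) ∘L A.graph.subtypeL
  have hrange : range S = range fun u : A.domain => z • (u : E) - A u := by
    refine Subset.antisymm ?_ (range_subset_iff.2 fun u => ⟨⟨_, A.mem_graph u⟩, rfl⟩)
    rintro _ ⟨⟨⟨x, y⟩, hp⟩, rfl⟩
    obtain ⟨u, rfl, rfl⟩ := A.mem_graph_iff.1 hp
    exact ⟨u, rfl⟩
  have hanti : AntilipschitzWith (Real.toNNReal ((‖z‖ + c + 1) / c)) S := by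
    refine S.antilipschitz_of_bound ?_
    rintro ⟨⟨x, y⟩, hp⟩
    obtain ⟨u, rfl, rfl⟩ := A.mem_graph_iff.1 hp
    rw [Real.coe_toNNReal _ (by positivity), div_mul_eq_mul_div, le_div_iff₀ hc]
    change max ‖(u : E)‖ ‖A u‖ * c ≤ (‖z‖ + c + 1) * ‖z • (u : E) - A u‖
    have hu := hb u
    have hAu : ‖A u‖ ≤ ‖z‖ * ‖(u : E)‖ + ‖z • (u : E) - A u‖ := by
      simpa [norm_smul] using norm_sub_le (z • (u : E)) (z • (u : E) - A u)
    have hz := norm_nonneg z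
    have hf := norm_nonneg (z • (u : E) - A u)
    rw [max_mul_of_nonneg _ _ hc.le]
    exact max_le (by nlinarith) (by nlinarith [norm_nonneg (u : E)])
  have : CompleteSpace A.graph := hA.completeSpace_coe
  have hclosed : IsClosed (range S) := hanti.isClosed_range S.uniformContinuous
  have : f ∈ range S := hclosed.closure_subset (by rw [hrange]; exact hr f)
  rwa [hrange] at this

end Operator

section Resolvent

variable {E : Type*}

section Normed

variable [NormedAddCommGroup E] [NormedSpace ℂ E] {A : E →ₗ.[ℂ] E} {z : ℂ}

theorem exists_isResolventAt_of_surjective {c : ℝ} (hc : 0 < c)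
    (hb : ∀ u : A.domain, c * ‖(u : E)‖ ≤ ‖z • (u : E) - A u‖)
    (hs : ∀ f : E, ∃ u : A.domain, z • (u : E) - A u = f) :
    ∃ R : E →L[ℂ] E, IsResolventAt A z R ∧ ‖R‖ ≤ 1 / c := by
  let S : A.domain →ₗ[ℂ] E := z • A.domain.subtype - A.toFun
  have hinj : Function.Injective S := (injective_iff_map_eq_zero S).2 fun u hu => by
    have h : c * ‖(u : E)‖ ≤ ‖S u‖ := hb u
    rw [hu, norm_zero] at h
    exact Subtype.ext (norm_le_zero_iff.1 (nonpos_of_mul_nonpos_right h hc))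
  let e := LinearEquiv.ofBijective S ⟨hinj, hs⟩
  have hbound (f : E) : ‖(A.domain.subtype ∘ₗ e.symm.toLinearMap) f‖ ≤ 1 / c * ‖f‖ := by
    have h : c * ‖(e.symm f : E)‖ ≤ ‖e (e.symm f)‖ := hb (e.symm f)
    rw [e.apply_symm_apply] at h
    rw [div_mul_eq_mul_div, one_mul, le_div_iff₀' hc]
    exact h
  exact ⟨LinearMap.mkContinuous _ (1 / c) hbound,
    ⟨fun f => ⟨e.symm f, rfl, e.apply_symm_apply f⟩,
      fun u => congrArg Subtype.val (e.symm_apply_apply u)⟩,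
    LinearMap.mkContinuous_norm_le _ (by positivity) _⟩

theorem exists_isResolventAt_vadd [CompleteSpace E] {B R : E →L[ℂ] E} (hR : IsResolventAt A z R)
    {q : ℝ} (hq : q < 1) (hB : ‖B ∘L R‖ ≤ q) :
    ∃ S : E →L[ℂ] E, IsResolventAt ((B : E →ₗ[ℂ] E) +ᵥ A) z S ∧ ‖S‖ ≤ ‖R‖ / (1 - q) := by
  let g : (E →L[ℂ] E)ˣ := Units.oneSub (B ∘L R) (hB.trans_lt hq)
  have hinv_norm : ‖(↑g⁻¹ : E →L[ℂ] E)‖ ≤ (1 - q)⁻¹ :=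
    calc ‖(↑g⁻¹ : E →L[ℂ] E)‖ ≤ ‖(1 : E →L[ℂ] E)‖ - 1 + (1 - ‖B ∘L R‖)⁻¹ :=
          tsum_geometric_le_of_norm_lt_one _ (hB.trans_lt hq)
      _ ≤ (1 - ‖B ∘L R‖)⁻¹ := by
          linarith [show ‖(1 : E →L[ℂ] E)‖ ≤ 1 from ContinuousLinearMap.norm_id_le]
      _ ≤ (1 - q)⁻¹ := inv_anti₀ (by linarith) (by linarith)
  have hfactor (u : A.domain) :
      z • (u : E) - ((B : E →ₗ[ℂ] E) +ᵥ A) u = (g : E →L[ℂ] E) (z • (u : E) - A u) := by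
    change z • (u : E) - (B u + A u) = z • (u : E) - A u - B (R (z • (u : E) - A u))
    rw [hR.2 u]
    abel
  refine ⟨R ∘L (↑g⁻¹ : E →L[ℂ] E), ⟨fun f => ?_, fun u => ?_⟩, ?_⟩
  · obtain ⟨u, hu, hf⟩ := hR.1 ((↑g⁻¹ : E →L[ℂ] E) f)
    refine ⟨u, hu, (hfactor u).trans ?_⟩
    rw [hf]
    exact DFunLike.congr_fun g.mul_inv f
  · rw [hfactor u]
    exact (congrArg R (DFunLike.congr_fun g.inv_mul (z • (u : E) - A u))).trans (hR.2 u)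
  · calc _ ≤ ‖R‖ * ‖(↑g⁻¹ : E →L[ℂ] E)‖ := ContinuousLinearMap.opNorm_comp_le _ _
      _ ≤ ‖R‖ * (1 - q)⁻¹ := by gcongr
      _ = ‖R‖ / (1 - q) := (div_eq_mul_inv _ _).symm

theorem norm_comp_le_of_relative_bound {B R : E →L[ℂ] E} (hR : IsResolventAt A z R) {k C : ℝ}
    (hk : 0 < k) (hC : 0 ≤ C)
    (hB : ∀ u : A.domain, k * ‖B (u : E)‖ ≤ C * (‖(u : E)‖ + ‖z • (u : E) - A u‖)) :
    ‖B ∘L R‖ ≤ C * (‖R‖ + 1) / k := by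
  refine ContinuousLinearMap.opNorm_le_bound _ (by positivity) fun f => ?_
  obtain ⟨u, hu, hf⟩ := hR.1 f
  have h := hB u
  rw [hf, hu] at h
  rw [div_mul_eq_mul_div, le_div_iff₀' hk, ContinuousLinearMap.comp_apply]
  calc k * ‖B (R f)‖ ≤ C * (‖R f‖ + ‖f‖) := h
    _ ≤ C * (‖R‖ * ‖f‖ + ‖f‖) := by gcongr; exact R.le_opNorm f
    _ = C * (‖R‖ + 1) * ‖f‖ := by ring

theorem notMem_opPointSpectrum_of_mem_opResolventSet (hz : z ∈ opResolventSet A) :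
    z ∉ opPointSpectrum A := by
  rintro ⟨u, hu, heq⟩
  obtain ⟨R, -, hR⟩ := hz
  exact hu (by rw [← hR u, heq, sub_self, map_zero])

end Normed

theorem IsQuasidissipative.exists_isResolventAt_closure [NormedAddCommGroup E]
    [InnerProductSpace ℂ E] [CompleteSpace E] {T : E →ₗ.[ℂ] E} {ω : ℝ}
    (hT : IsQuasidissipative T ω) (hdom : Dense (T.domain : Set E)) {z : ℂ} (hz : ω < z.re)
    (hr : DenseRange fun u : T.domain => z • (u : E) - T u) :
    ∃ R : E →L[ℂ] E, IsResolventAt T.closure z R ∧ ‖R‖ ≤ 1 / (z.re - ω) := by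
  have hc : 0 < z.re - ω := sub_pos.2 hz
  have hb (u : T.closure.domain) := sub_mul_norm_le_norm_smul_sub (hT.closure hdom u) z
  have hr' : DenseRange fun u : T.closure.domain => z • (u : E) - T.closure u := by
    refine hr.mono (range_subset_iff.2 fun u => ?_)
    obtain ⟨v, huv, hTuv⟩ := LinearPMap.exists_of_le T.le_closure u
    exact ⟨v, by simp only [huv, hTuv]⟩
  exact exists_isResolventAt_of_surjective hc hb fun f =>
    exists_smul_sub_eq_of_denseRange (hT.isClosable hdom).closure_isClosed hc hb hr' f

end Resolvent

section Coordinates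

/-- The coordinate `u' / ρ` of `u ∈ H̃₁`, in which the norm of `H̃₁` is that of `L²(0,1)`. At the
origin `x / 0 = 0` gives the right value only if `u''(0) = 0`. -/
noncomputable def H1t.weightedD (u : H1t) (ρ : ℝ) : ℂ := D u.fn ρ / ρ

theorem H1t.weightedD_zero (u : H1t) : u.weightedD 0 = 0 := by simp [H1t.weightedD]

theorem H1t.mul_weightedD (u : H1t) (ρ : ℝ) : ρ * u.weightedD ρ = D u.fn ρ := by
  rcases eq_or_ne ρ 0 with rfl | hρ
  · rw [Complex.ofReal_zero, zero_mul, u.mem.2.2]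
  · exact mul_div_cancel₀ _ (Complex.ofReal_ne_zero.2 hρ)

theorem H1t.weightedD_smul_sub (z : ℂ) (u v : H1t) {ρ : ℝ} (hρ : ρ ∈ I) :
    (z • u - v).weightedD ρ = z * u.weightedD ρ - v.weightedD ρ := by
  have h : D (z • u - v).fn ρ = z * D u.fn ρ - D v.fn ρ :=
    D_eq hρ (((hasD u.mem.1.1 one_le_two hρ).const_smul z).sub (hasD v.mem.1.1 one_le_two hρ))
  rw [H1t.weightedD, h, sub_div, mul_div_assoc, H1t.weightedD, H1t.weightedD]

theorem H1t.weightedD_sub (u v : H1t) {ρ : ℝ} (hρ : ρ ∈ I) :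
    (u - v).weightedD ρ = u.weightedD ρ - v.weightedD ρ := by
  simpa only [one_smul, one_mul] using H1t.weightedD_smul_sub 1 u v hρ

theorem H2t.D_smul_sub (z : ℂ) (u v : H2t) {ρ : ℝ} (hρ : ρ ∈ I) :
    D (z • u - v).fn ρ = z * D u.fn ρ - D v.fn ρ :=
  D_eq hρ (((hasD u.mem.1.1 le_rfl hρ).const_smul z).sub (hasD v.mem.1.1 le_rfl hρ))

theorem H2t.D_sub (u v : H2t) {ρ : ℝ} (hρ : ρ ∈ I) : D (u - v).fn ρ = D u.fn ρ - D v.fn ρ := by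
  simpa only [one_smul, one_mul] using H2t.D_smul_sub 1 u v hρ

theorem H1t.conj_D_mul_D_div (u v : H1t) (ρ : ℝ) :
    conj (D u.fn ρ) * D v.fn ρ / (ρ : ℂ) ^ 2 = v.weightedD ρ * conj (u.weightedD ρ) := by
  rw [H1t.weightedD, H1t.weightedD, map_div₀, Complex.conj_ofReal, div_mul_div_comm, sq,
    mul_comm (D v.fn ρ)]

theorem intervalIntegrable_mul_conj (u v : Ht) :
    IntervalIntegrable (fun ρ => v.fst.weightedD ρ * conj (u.fst.weightedD ρ) +
      D v.snd.fn ρ * conj (D u.snd.fn ρ)) volume 0 1 := by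
  simpa only [H1t.conj_D_mul_D_div, mul_comm (conj (D u.snd.fn _))] using
    (integrable1 u.fst v.fst).add (integrable2 u.snd v.snd)

theorem inner_eq_integral (u v : Ht) :
    ⟪u, v⟫_ℂ = ∫ ρ in (0 : ℝ)..1, (v.fst.weightedD ρ * conj (u.fst.weightedD ρ) +
      D v.snd.fn ρ * conj (D u.snd.fn ρ)) := by
  have h := intervalIntegral.integral_add (integrable1 u.fst v.fst) (integrable2 u.snd v.snd)
  exact h.symm.trans (by simp only [H1t.conj_D_mul_D_div, mul_comm (conj (D u.snd.fn _))])

theorem intervalIntegrable_inner (u v : Ht) :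
    IntervalIntegrable (fun ρ => ⟪u.fst.weightedD ρ, v.fst.weightedD ρ⟫_ℝ +
      ⟪D u.snd.fn ρ, D v.snd.fn ρ⟫_ℝ) volume 0 1 := by
  simp only [Complex.inner, ← Complex.add_re]
  exact ⟨(intervalIntegrable_mul_conj u v).1.re, (intervalIntegrable_mul_conj u v).2.re⟩

theorem re_inner_eq_integral (u v : Ht) :
    (⟪u, v⟫_ℂ).re = ∫ ρ in (0 : ℝ)..1, (⟪u.fst.weightedD ρ, v.fst.weightedD ρ⟫_ℝ +
      ⟪D u.snd.fn ρ, D v.snd.fn ρ⟫_ℝ) := by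
  rw [inner_eq_integral]
  simp only [Complex.inner, ← Complex.add_re]
  exact (Complex.reCLM.intervalIntegral_comp_comm (intervalIntegrable_mul_conj u v)).symm

theorem intervalIntegrable_norm_sq (u : Ht) :
    IntervalIntegrable (fun ρ => ‖u.fst.weightedD ρ‖ ^ 2 + ‖D u.snd.fn ρ‖ ^ 2) volume 0 1 := by
  simpa only [real_inner_self_eq_norm_sq] using intervalIntegrable_inner u u

theorem norm_sq_eq_integral (u : Ht) :
    ‖u‖ ^ 2 = ∫ ρ in (0 : ℝ)..1, (‖u.fst.weightedD ρ‖ ^ 2 + ‖D u.snd.fn ρ‖ ^ 2) := by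
  simp only [← real_inner_self_eq_norm_sq (_ : ℂ), ← re_inner_eq_integral]
  exact norm_sq_eq_re_inner (𝕜 := ℂ) u

theorem norm_sq_le_of_sq_add_sq_le {w v : Ht} {a b : ℝ}
    (h : ∀ ρ ∈ Ioo (0 : ℝ) 1, ‖w.fst.weightedD ρ‖ ^ 2 + ‖D w.snd.fn ρ‖ ^ 2 ≤
      a + b * (‖v.fst.weightedD ρ‖ ^ 2 + ‖D v.snd.fn ρ‖ ^ 2)) :
    ‖w‖ ^ 2 ≤ a + b * ‖v‖ ^ 2 := by
  have hv := (intervalIntegrable_norm_sq v).const_mul b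
  calc ‖w‖ ^ 2 = _ := norm_sq_eq_integral w
    _ ≤ ∫ ρ in (0 : ℝ)..1, (a + b * (‖v.fst.weightedD ρ‖ ^ 2 + ‖D v.snd.fn ρ‖ ^ 2)) :=
      intervalIntegral.integral_mono_on_of_le_Ioo zero_le_one (intervalIntegrable_norm_sq w)
        (intervalIntegrable_const.add hv) h
    _ = a + b * ‖v‖ ^ 2 := by
      rw [intervalIntegral.integral_add intervalIntegrable_const hv,
        intervalIntegral.integral_const_mul, ← norm_sq_eq_integral, intervalIntegral.integral_const,
        sub_zero, one_smul]

theorem norm_le_of_sq_add_sq_le {u : Ht} {c : ℝ} (hc : 0 ≤ c)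
    (h : ∀ ρ ∈ Ioo (0 : ℝ) 1, ‖u.fst.weightedD ρ‖ ^ 2 + ‖D u.snd.fn ρ‖ ^ 2 ≤ c ^ 2) :
    ‖u‖ ≤ c :=
  le_of_sq_le_sq (by simpa using norm_sq_le_of_sq_add_sq_le (v := u) (b := 0) (by simpa using h)) hc

theorem ext_of_weightedD_eq {u v : Ht}
    (h₁ : ∀ ρ ∈ Ioo (0 : ℝ) 1, u.fst.weightedD ρ = v.fst.weightedD ρ)
    (h₂ : ∀ ρ ∈ Ioo (0 : ℝ) 1, D u.snd.fn ρ = D v.snd.fn ρ) : u = v := by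
  refine sub_eq_zero.1 (norm_le_zero_iff.1 (norm_le_of_sq_add_sq_le le_rfl fun ρ hρ => ?_))
  have hρ' := Ioo_subset_Icc_self hρ
  rw [WithLp.sub_fst, WithLp.sub_snd, H1t.weightedD_sub _ _ hρ', H2t.D_sub _ _ hρ', h₁ ρ hρ,
    h₂ ρ hρ]
  simp

theorem contDiffOn_weightedD (u : domL0t) : ContDiffOn ℝ (1 : ℕ) u.1.fst.weightedD I :=
  contDiffOn_div (contDiffOn_D u.2.1.1.1 (by norm_num)) u.2.1.2.2.1 u.2.1.2.2.2

theorem contDiffOn_D_snd (u : domL0t) : ContDiffOn ℝ (2 : ℕ) (D u.1.snd.fn) I :=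
  contDiffOn_D u.2.2.1.1 (by norm_num)

theorem weightedD_L0fun (u : domL0t) {ρ : ℝ} (hρ : ρ ∈ I) (h0 : ρ ≠ 0) :
    (L0fun u).fst.weightedD ρ =
      -u.1.fst.weightedD ρ - ρ * D u.1.fst.weightedD ρ + D (D u.1.snd.fn) ρ := by
  have hD₁ := hasD (contDiffOn_D u.2.1.1.1 (m := 2) (by norm_num)) (by norm_num) hρ
  have hD₂ := hasD (contDiffOn_D_snd u) one_le_two hρ
  have product_rule : D (D u.1.fst.fn) ρ =
      u.1.fst.weightedD ρ + ρ * D u.1.fst.weightedD ρ := by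
    rw [D_congr (fun x _ => (u.1.fst.mul_weightedD x).symm) hρ]
    exact D_eq hρ ((hasD_id.mul (hasD (contDiffOn_weightedD u) le_rfl hρ)).congr_deriv (by ring))
  have hD : D (L0fun u).fst.fn ρ = ρ * (D (D u.1.snd.fn) ρ - D (D u.1.fst.fn) ρ) := by
    refine (D_indicator hρ).trans (D_eq hρ ?_)
    refine (((((hasD_id (ρ := ρ)).neg.mul hD₁).add (hasD u.2.1.1.1 (by norm_num) hρ)).add
      (hasD_id.mul hD₂)).sub (hasD u.2.2.1.1 (by norm_num) hρ)).congr_deriv ?_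
    simp only [Pi.neg_apply]
    ring
  rw [H1t.weightedD, hD, product_rule, mul_div_cancel_left₀ _ (Complex.ofReal_ne_zero.2 h0)]
  ring

theorem D_L0fun_snd (u : domL0t) {ρ : ℝ} (hρ : ρ ∈ I) : D (L0fun u).snd.fn ρ =
    D u.1.fst.weightedD ρ - D u.1.snd.fn ρ - ρ * D (D u.1.snd.fn) ρ := by
  refine (D_indicator hρ).trans (D_eq hρ ?_)
  exact ((hasD (contDiffOn_weightedD u) le_rfl hρ).sub
    (hasD_id.mul (hasD (contDiffOn_D_snd u) one_le_two hρ))).congr_deriv (by ring)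

end Coordinates

section Dissipativity

/-- The integrand plus `(‖a‖² + ‖b‖²) / 2` is the derivative of
`⟪a, b⟫ - ρ (‖a‖² + ‖b‖²) / 2`. -/
theorem integral_inner_transport {F : Type*} [NormedAddCommGroup F] [InnerProductSpace ℝ F]
    {a b a' b' : ℝ → F} (ha : ContinuousOn a I) (hb : ContinuousOn b I)
    (ha' : ∀ ρ ∈ Ioo (0 : ℝ) 1, HasDerivAt a (a' ρ) ρ)
    (hb' : ∀ ρ ∈ Ioo (0 : ℝ) 1, HasDerivAt b (b' ρ) ρ)
    (hint : IntervalIntegrable (fun ρ => ⟪a ρ, -a ρ - ρ • a' ρ + b' ρ⟫_ℝ +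
      ⟪b ρ, a' ρ - b ρ - ρ • b' ρ⟫_ℝ) volume 0 1) :
    ∫ ρ in (0 : ℝ)..1, (⟪a ρ, -a ρ - ρ • a' ρ + b' ρ⟫_ℝ + ⟪b ρ, a' ρ - b ρ - ρ • b' ρ⟫_ℝ) =
      -(1 / 2) * (∫ ρ in (0 : ℝ)..1, (‖a ρ‖ ^ 2 + ‖b ρ‖ ^ 2)) - ‖a 1 - b 1‖ ^ 2 / 2 -
        ⟪a 0, b 0⟫_ℝ := by
  have hsq : ContinuousOn (fun ρ => ‖a ρ‖ ^ 2 + ‖b ρ‖ ^ 2) I := (ha.norm.pow 2).add (hb.norm.pow 2)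
  have hsq_int : IntervalIntegrable (fun ρ => 1 / 2 * (‖a ρ‖ ^ 2 + ‖b ρ‖ ^ 2)) volume 0 1 :=
    (hsq.intervalIntegrable_of_Icc zero_le_one).const_mul _
  have energy := intervalIntegral.integral_eq_sub_of_hasDerivAt_of_le zero_le_one
    (f := fun ρ => ⟪a ρ, b ρ⟫_ℝ - ρ / 2 * (‖a ρ‖ ^ 2 + ‖b ρ‖ ^ 2))
    ((ha.inner hb).sub ((continuousOn_id.div_const 2).mul hsq))
    (fun ρ hρ => by
      have hab := (ha' ρ hρ).inner ℝ (hb' ρ hρ)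
      have hsq' := ((hasDerivAt_id ρ).div_const 2).mul
        ((ha' ρ hρ).norm_sq.add (hb' ρ hρ).norm_sq)
      refine (hab.sub hsq').congr_deriv (g' := ⟪a ρ, -a ρ - ρ • a' ρ + b' ρ⟫_ℝ +
        ⟪b ρ, a' ρ - b ρ - ρ • b' ρ⟫_ℝ + 1 / 2 * (‖a ρ‖ ^ 2 + ‖b ρ‖ ^ 2)) ?_
      simp only [inner_add_right, inner_sub_right, inner_neg_right, inner_smul_right,
        real_inner_self_eq_norm_sq, real_inner_comm (b ρ) (a' ρ), id, Pi.add_apply]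
      ring)
    (hint.add hsq_int)
  rw [intervalIntegral.integral_add hint hsq_int, intervalIntegral.integral_const_mul] at energy
  linear_combination energy + (1 / 2) * norm_sub_sq_real (a 1) (b 1)

theorem hasDerivAt_D {u : ℝ → ℂ} {n : ℕ} (hu : ContDiffOn ℝ n u I) (hn : 1 ≤ n) {ρ : ℝ}
    (hρ : ρ ∈ Ioo (0 : ℝ) 1) : HasDerivAt u (D u ρ) ρ :=
  (hasD hu hn (Ioo_subset_Icc_self hρ)).hasDerivAt (Icc_mem_nhds hρ.1 hρ.2)

theorem re_inner_L0fun_le (u : domL0t) :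
    (⟪u.1, L0fun u⟫_ℂ).re ≤ -(1 / 2) * ‖u.1‖ ^ 2 := by
  have ha := contDiffOn_weightedD u
  have hb := contDiffOn_D_snd u
  have hL0 : EqOn (fun ρ => ⟪u.1.fst.weightedD ρ, (L0fun u).fst.weightedD ρ⟫_ℝ +
      ⟪D u.1.snd.fn ρ, D (L0fun u).snd.fn ρ⟫_ℝ)
      (fun ρ => ⟪u.1.fst.weightedD ρ,
        -u.1.fst.weightedD ρ - ρ • D u.1.fst.weightedD ρ + D (D u.1.snd.fn) ρ⟫_ℝ +
      ⟪D u.1.snd.fn ρ, D u.1.fst.weightedD ρ - D u.1.snd.fn ρ - ρ • D (D u.1.snd.fn) ρ⟫_ℝ)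
      (Ioc 0 1) := fun ρ hρ => by
    have hρ' := Ioc_subset_Icc_self hρ
    simp only [weightedD_L0fun u hρ' hρ.1.ne', D_L0fun_snd u hρ', Complex.real_smul]
  have hint := (intervalIntegrable_inner u.1 (L0fun u)).congr
    (by rwa [uIoc_of_le (zero_le_one (α := ℝ))])
  have hcongr := intervalIntegral.integral_congr_ae (μ := volume) (a := 0) (b := 1)
    (ae_of_all _ fun ρ hρ => hL0 (by rwa [uIoc_of_le zero_le_one] at hρ))
  rw [re_inner_eq_integral, norm_sq_eq_integral, hcongr,
    integral_inner_transport ha.continuousOn hb.continuousOn (fun ρ => hasDerivAt_D ha le_rfl)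
      (fun ρ => hasDerivAt_D hb one_le_two) hint, H1t.weightedD_zero, inner_zero_left]
  linarith [sq_nonneg ‖u.1.fst.weightedD 1 - D u.1.snd.fn 1‖]

end Dissipativity

section Primitives

theorem contDiffOn_succ_of_hasDerivWithinAt {f f' : ℝ → ℂ} {n : ℕ} (hf' : ContDiffOn ℝ n f' I)
    (h : ∀ ρ ∈ I, HasDerivWithinAt f (f' ρ) I ρ) : ContDiffOn ℝ (n + 1 : ℕ) f I := by
  rw [Nat.cast_add, Nat.cast_one, contDiffOn_succ_iff_derivWithin uniqueDiff]
  exact ⟨fun ρ hρ => (h ρ hρ).differentiableWithinAt,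
    fun hω => (WithTop.coe_ne_top hω).elim, hf'.congr fun ρ hρ => D_eq hρ (h ρ hρ)⟩

/-- The primitive of `b` that vanishes at the origin. -/
noncomputable def primitive (b : ℝ → ℂ) (ρ : ℝ) : ℂ := ∫ r in (0 : ℝ)..ρ, b r

theorem primitive_zero (b : ℝ → ℂ) : primitive b 0 = 0 := intervalIntegral.integral_same

theorem hasD_primitive {b : ℝ → ℂ} (hb : ContinuousOn b I) {ρ : ℝ} (hρ : ρ ∈ I) :
    HasDerivWithinAt (primitive b) (b ρ) I ρ := by
  have : Fact (ρ ∈ Icc (0 : ℝ) 1) := ⟨hρ⟩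
  exact intervalIntegral.integral_hasDerivWithinAt_right
    ((hb.mono (Icc_subset_Icc_right hρ.2)).intervalIntegrable_of_Icc hρ.1)
    (hb.stronglyMeasurableAtFilter_nhdsWithin measurableSet_Icc ρ) (hb ρ hρ)

theorem contDiffOn_primitive {b : ℝ → ℂ} {n : ℕ} (hb : ContDiffOn ℝ n b I) :
    ContDiffOn ℝ (n + 1 : ℕ) (primitive b) I :=
  contDiffOn_succ_of_hasDerivWithinAt hb fun _ => hasD_primitive hb.continuousOn

theorem K_zero (a : ℝ → ℂ) : K a 0 = 0 := intervalIntegral.integral_same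

theorem D_indicator_K {a : ℝ → ℂ} (ha : ContinuousOn a I) {ρ : ℝ} (hρ : ρ ∈ I) :
    D (I.indicator (K a)) ρ = ρ * a ρ :=
  (D_indicator hρ).trans (D_eq hρ (hasD_K ha hρ))

theorem indicator_K_mem {a : ℝ → ℂ} (ha : ContDiffOn ℝ (1 : ℕ) a I) :
    I.indicator (K a) ∈ preH1 :=
  ⟨mem_Ck_indicator (contDiffOn_K ha), (indicator_of_mem zero_mem_I _).trans (K_zero a), by
    rw [D_indicator_K ha.continuousOn zero_mem_I, Complex.ofReal_zero, zero_mul]⟩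

theorem indicator_primitive_mem {b : ℝ → ℂ} (hb : ContinuousOn b I) :
    I.indicator (primitive b) ∈ preH2 :=
  ⟨mem_Ck_indicator (contDiffOn_primitive (n := 0) (contDiffOn_zero.2 hb)),
    (indicator_of_mem zero_mem_I _).trans (primitive_zero b)⟩

/-- The element `u` of `H̃₁` with `u' = ρ a`, that is, with `u' / ρ = a` away from the origin. -/
noncomputable def H1t.ofWeightedD (a : ℝ → ℂ) (ha : ContDiffOn ℝ (1 : ℕ) a I) : H1t :=
  H1t.mk (I.indicator (K a)) (indicator_K_mem ha)

/-- The element `u` of `H̃₂` with `u' = b`. -/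
noncomputable def H2t.ofD (b : ℝ → ℂ) (hb : ContinuousOn b I) : H2t :=
  H2t.mk (I.indicator (primitive b)) (indicator_primitive_mem hb)

theorem H1t.D_ofWeightedD {a : ℝ → ℂ} (ha : ContDiffOn ℝ (1 : ℕ) a I) {ρ : ℝ} (hρ : ρ ∈ I) :
    D (H1t.ofWeightedD a ha).fn ρ = ρ * a ρ :=
  D_indicator_K ha.continuousOn hρ

theorem H1t.weightedD_ofWeightedD {a : ℝ → ℂ} (ha : ContDiffOn ℝ (1 : ℕ) a I) {ρ : ℝ}
    (hρ : ρ ∈ I) (h0 : ρ ≠ 0) : (H1t.ofWeightedD a ha).weightedD ρ = a ρ := by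
  rw [H1t.weightedD, H1t.D_ofWeightedD ha hρ, mul_div_cancel_left₀ _ (Complex.ofReal_ne_zero.2 h0)]

theorem H2t.D_ofD {b : ℝ → ℂ} (hb : ContinuousOn b I) {ρ : ℝ} (hρ : ρ ∈ I) :
    D (H2t.ofD b hb).fn ρ = b ρ :=
  (D_indicator hρ).trans (D_eq hρ (hasD_primitive hb hρ))

/-- The element `u` of `H̃` with `u₁' = ρ a` and `u₂' = b`. -/
noncomputable def ofDeriv (a b : ℝ → ℂ) (ha : ContDiffOn ℝ (1 : ℕ) a I) (hb : ContinuousOn b I) :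
    Ht :=
  WithLp.toLp 2 (H1t.ofWeightedD a ha, H2t.ofD b hb)

theorem ofDeriv_mem_domL0t {a b : ℝ → ℂ} (ha : ContDiffOn ℝ (2 : ℕ) a I)
    (hb : ContDiffOn ℝ (2 : ℕ) b I) (h0 : a 0 = 0) :
    ofDeriv a b (ha.of_le (mod_cast one_le_two)) hb.continuousOn ∈ domL0t := by
  have ha₁ : ContDiffOn ℝ (1 : ℕ) a I := ha.of_le (mod_cast one_le_two)
  have hK : ContDiffOn ℝ (3 : ℕ) (K a) I :=
    contDiffOn_succ_of_hasDerivWithinAt (contDiffOn_id'.mul ha) fun _ => hasD_K ha.continuousOn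
  have hDD : D (D (H1t.ofWeightedD a ha₁).fn) 0 = 0 := by
    rw [D_congr (fun ρ => H1t.D_ofWeightedD ha₁) zero_mem_I]
    exact D_eq zero_mem_I
      ((hasD_id.mul (hasD ha₁ le_rfl zero_mem_I)).congr_deriv (by rw [h0]; simp))
  exact ⟨⟨mem_Ck_indicator hK, (H1t.mem _).2.1, (H1t.mem _).2.2, hDD⟩,
    mem_Ck_indicator (contDiffOn_primitive hb), (H2t.mem _).2⟩

end Primitives

section PolynomialData

open Polynomial

theorem exists_polynomial_norm_sub_le {f : ℝ → ℂ} (hf : ContinuousOn f I) {ε : ℝ} (hε : 0 < ε) :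
    ∃ P : ℂ[X], ∀ ρ ∈ I, ‖f ρ - P.eval (ρ : ℂ)‖ ≤ ε := by
  obtain ⟨p, hp⟩ := exists_polynomial_near_of_continuousOn 0 1 (fun ρ => (f ρ).re)
    (Complex.continuous_re.comp_continuousOn hf) (ε / 2) (half_pos hε)
  obtain ⟨q, hq⟩ := exists_polynomial_near_of_continuousOn 0 1 (fun ρ => (f ρ).im)
    (Complex.continuous_im.comp_continuousOn hf) (ε / 2) (half_pos hε)
  have eval_map_ofReal (r : ℝ[X]) (ρ : ℝ) :
      (r.map Complex.ofRealHom).eval (ρ : ℂ) = (r.eval ρ : ℝ) :=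
    eval_map_apply Complex.ofRealHom ρ
  refine ⟨p.map Complex.ofRealHom + C Complex.I * q.map Complex.ofRealHom, fun ρ hρ => ?_⟩
  calc _ ≤ _ := Complex.norm_le_abs_re_add_abs_im _
    _ = |p.eval ρ - (f ρ).re| + |q.eval ρ - (f ρ).im| := by
      simp [eval_map_ofReal, abs_sub_comm]
    _ ≤ ε / 2 + ε / 2 := add_le_add (hp ρ hρ).le (hq ρ hρ).le
    _ = ε := add_halves ε

theorem contDiffOn_eval (P : ℂ[X]) {n : ℕ} :
    ContDiffOn ℝ n (fun ρ : ℝ => P.eval (ρ : ℂ)) I :=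
  ((P.contDiff_aeval (𝕜 := ℂ) n).restrict_scalars ℝ |>.comp
    Complex.ofRealCLM.contDiff).contDiffOn

theorem hasD_eval (P : ℂ[X]) (ρ : ℝ) :
    HasDerivWithinAt (fun ρ : ℝ => P.eval (ρ : ℂ)) (P.derivative.eval (ρ : ℂ)) I ρ :=
  (P.hasDerivAt (ρ : ℂ)).comp_ofReal.hasDerivWithinAt

theorem exists_C_mul_add_X_mul_derivative_eq {k : Type*} [Field k] {μ : k}
    (hμ : ∀ n : ℕ, μ + n ≠ 0) (F : k[X]) : ∃ P : k[X], C μ * P + X * derivative P = F := by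
  induction F using Polynomial.induction_on' with
  | add p q hp hq =>
    obtain ⟨P, rfl⟩ := hp
    obtain ⟨Q, rfl⟩ := hq
    exact ⟨P + Q, by rw [derivative_add]; ring⟩
  | monomial n a =>
    refine ⟨monomial n (a / (μ + n)), ?_⟩
    have hX : X * derivative (monomial n (a / (μ + n))) = monomial n (a / (μ + n) * n) := by
      cases n <;> simp [X_mul_monomial]
    rw [C_mul_monomial, hX, ← map_add, mul_comm μ, ← mul_add, div_mul_cancel₀ _ (hμ n)]

theorem exists_C_mul_add_X_add_C_mul_derivative_eq {k : Type*} [Field k] {μ : k}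
    (hμ : ∀ n : ℕ, μ + n ≠ 0) (c : k) (F : k[X]) :
    ∃ P : k[X], C μ * P + (X + C c) * derivative P = F := by
  obtain ⟨P, hP⟩ := exists_C_mul_add_X_mul_derivative_eq hμ (F.comp (X - C c))
  refine ⟨P.comp (X + C c), ?_⟩
  have h := congrArg (fun Q => Q.comp (X + C c)) hP
  simpa [derivative_comp, comp_assoc] using h

/-- The element `u` of `H̃` with `u₁' = ρ F` and `u₂' = G`, where `F` and `G` are polynomials. -/
noncomputable def ofPoly (F G : ℂ[X]) : Ht :=
  ofDeriv (fun ρ => F.eval (ρ : ℂ)) (fun ρ => G.eval (ρ : ℂ)) (contDiffOn_eval F)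
    (contDiffOn_eval G (n := 0)).continuousOn

theorem weightedD_ofPoly (F G : ℂ[X]) {ρ : ℝ} (hρ : ρ ∈ I) (h0 : ρ ≠ 0) :
    (ofPoly F G).fst.weightedD ρ = F.eval (ρ : ℂ) :=
  H1t.weightedD_ofWeightedD (contDiffOn_eval F) hρ h0

theorem D_ofPoly_snd (F G : ℂ[X]) {ρ : ℝ} (hρ : ρ ∈ I) :
    D (ofPoly F G).snd.fn ρ = G.eval (ρ : ℂ) :=
  H2t.D_ofD (contDiffOn_eval G (n := 0)).continuousOn hρ

theorem ofPoly_mem_domL0t {F G : ℂ[X]} (hF : F.eval 0 = 0) : ofPoly F G ∈ domL0t :=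
  ofDeriv_mem_domL0t (contDiffOn_eval F) (contDiffOn_eval G) (by simpa using hF)

/-- The mean value inequality turns an approximation of `u₁''` into one of `u₁' / ρ`. -/
theorem exists_polynomial_norm_weightedD_sub_le (u : H1t) {ε : ℝ} (hε : 0 < ε) :
    ∃ F : ℂ[X], ∀ ρ ∈ Ioo (0 : ℝ) 1, ‖u.weightedD ρ - F.eval (ρ : ℂ)‖ ≤ ε := by
  have hDu : ContDiffOn ℝ (1 : ℕ) (D u.fn) I := contDiffOn_D u.mem.1.1 (by norm_num)
  obtain ⟨P, hP⟩ := exists_polynomial_norm_sub_le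
    (contDiffOn_D hDu (m := 0) (by norm_num)).continuousOn hε
  obtain ⟨F, rfl⟩ := exists_C_mul_add_X_mul_derivative_eq (μ := (1 : ℂ))
    (fun n => by exact_mod_cast (Nat.one_add n ▸ n.succ_ne_zero)) P
  refine ⟨F, fun ρ hρ => ?_⟩
  have hρ' := Ioo_subset_Icc_self hρ
  have hD : ∀ r ∈ I, HasDerivWithinAt (fun r : ℝ => D u.fn r - (X * F).eval (r : ℂ))
      (D (D u.fn) r - (C 1 * F + X * derivative F).eval (r : ℂ)) I r := fun r hr =>
    ((hasD hDu le_rfl hr).sub (hasD_eval (X * F) r)).congr_deriv (by simp)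
  have mvt := (convex_Icc (0 : ℝ) 1).norm_image_sub_le_of_norm_hasDerivWithin_le hD hP zero_mem_I
    hρ'
  have hρ_norm : ‖(ρ : ℂ)‖ = ρ := Complex.norm_of_nonneg hρ.1.le
  refine le_of_mul_le_mul_left ?_ hρ.1
  calc ρ * ‖u.weightedD ρ - F.eval (ρ : ℂ)‖ = ‖D u.fn ρ - (X * F).eval (ρ : ℂ)‖ := by
        rw [← u.mul_weightedD, eval_mul, eval_X, ← mul_sub, norm_mul, hρ_norm]
    _ ≤ ρ * ε := by simpa [u.mem.2.2, abs_of_pos hρ.1, mul_comm] using mvt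

theorem exists_norm_ofPoly_sub_le (u : Ht) {ε : ℝ} (hε : 0 < ε) :
    ∃ F G : ℂ[X], ‖u - ofPoly F G‖ ≤ ε := by
  obtain ⟨F, hF⟩ := exists_polynomial_norm_weightedD_sub_le u.fst (half_pos hε)
  obtain ⟨G, hG⟩ := exists_polynomial_norm_sub_le (contOn_D2 u.snd) (half_pos hε)
  refine ⟨F, G, norm_le_of_sq_add_sq_le hε.le fun ρ hρ => ?_⟩
  have hρ' := Ioo_subset_Icc_self hρ
  rw [WithLp.sub_fst, WithLp.sub_snd, H1t.weightedD_sub _ _ hρ', H2t.D_sub _ _ hρ',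
    weightedD_ofPoly _ _ hρ' hρ.1.ne', D_ofPoly_snd _ _ hρ']
  have h₁ := pow_le_pow_left₀ (norm_nonneg _) (hF ρ hρ) 2
  have h₂ := pow_le_pow_left₀ (norm_nonneg _) (hG ρ hρ') 2
  linarith [sq_nonneg ε]

theorem dense_range_ofPoly : Dense (range fun P : ℂ[X] × ℂ[X] => ofPoly P.1 P.2) := by
  refine Metric.dense_iff.2 fun u ε hε => ?_
  obtain ⟨F, G, h⟩ := exists_norm_ofPoly_sub_le u (half_pos hε)
  refine ⟨ofPoly F G, ?_, (F, G), rfl⟩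
  rw [Metric.mem_ball, dist_comm, dist_eq_norm]
  linarith

theorem norm_ofPoly_sub_sq (F G : ℂ[X]) (c : ℂ) (n : ℕ) :
    ‖ofPoly (F - C c * (1 - X) ^ n) G - ofPoly F G‖ ^ 2 = ‖c‖ ^ 2 / (2 * n + 1) := by
  have hint : ∀ ρ ∈ Ioo (0 : ℝ) 1,
      ‖(ofPoly (F - C c * (1 - X) ^ n) G - ofPoly F G).fst.weightedD ρ‖ ^ 2 +
        ‖D (ofPoly (F - C c * (1 - X) ^ n) G - ofPoly F G).snd.fn ρ‖ ^ 2 =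
      ‖c‖ ^ 2 * (1 - ρ) ^ (2 * n) := fun ρ hρ => by
    have hρ' := Ioo_subset_Icc_self hρ
    have hnorm : ‖(1 : ℂ) - ρ‖ = 1 - ρ := by
      rw [← Complex.ofReal_one, ← Complex.ofReal_sub, Complex.norm_of_nonneg (sub_pos.2 hρ.2).le]
    rw [WithLp.sub_fst, WithLp.sub_snd, H1t.weightedD_sub _ _ hρ', H2t.D_sub _ _ hρ']
    simp [weightedD_ofPoly _ _ hρ' hρ.1.ne', D_ofPoly_snd _ _ hρ', hnorm, mul_pow, ← pow_mul,
      mul_comm n]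
  rw [norm_sq_eq_integral, intervalIntegral.integral_of_le zero_le_one,
    integral_Ioc_eq_integral_Ioo, setIntegral_congr_fun measurableSet_Ioo hint,
    ← integral_Ioc_eq_integral_Ioo, ← intervalIntegral.integral_of_le zero_le_one,
    intervalIntegral.integral_const_mul,
    intervalIntegral.integral_comp_sub_left (fun x : ℝ => x ^ (2 * n)) 1, integral_pow]
  simp [div_eq_mul_inv]

/-- The constraint `F(0) = 0` is removed by a peak `F(0) (1 - ρ)ⁿ` of small `L²` norm. -/
theorem dense_domL0t : Dense (domL0t : Set Ht) := by
  refine dense_closure.1 (dense_range_ofPoly.mono (range_subset_iff.2 fun ⟨F, G⟩ => ?_))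
  have hlim : Tendsto (fun n : ℕ => ‖F.eval 0‖ ^ 2 / (2 * n + 1)) atTop (𝓝 0) :=
    tendsto_const_nhds.div_atTop (tendsto_atTop_add_const_right _ _
      (tendsto_natCast_atTop_atTop.const_mul_atTop two_pos))
  have hnorm := hlim.sqrt
  simp only [← norm_ofPoly_sub_sq F G, Real.sqrt_sq (norm_nonneg _), Real.sqrt_zero] at hnorm
  exact mem_closure_of_tendsto (tendsto_iff_norm_sub_tendsto_zero.2 hnorm)
    (Eventually.of_forall fun n => ofPoly_mem_domL0t (by simp))

end PolynomialData

section Range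

open Polynomial

theorem add_natCast_ne_zero {μ : ℂ} (hμ : 0 < μ.re) (n : ℕ) : μ + n ≠ 0 := fun h => by
  have hre : μ.re + n = 0 := by simpa using congrArg Complex.re h
  linarith [n.cast_nonneg (α := ℝ)]

/-- The solution of `μ e + (1 + ρ) e' = 0` is `e = (1 + ρ)^(-μ)`. -/
theorem exists_homogeneous_transport_solution (μ : ℂ) (n : ℕ) :
    ∃ e : ℝ → ℂ, ContDiffOn ℝ n e I ∧ e 0 = 1 ∧ ∀ ρ ∈ I, μ * e ρ + (ρ + 1) * D e ρ = 0 := by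
  have hpos : ∀ ρ ∈ I, 1 + ρ ≠ 0 := fun ρ hρ => by linarith [hρ.1]
  refine ⟨fun ρ => Complex.exp (-μ * (Real.log (1 + ρ) : ℝ)), ?_, by simp, fun ρ hρ => ?_⟩
  · exact (contDiffOn_const.mul (Complex.ofRealCLM.contDiff.comp_contDiffOn
      ((contDiffOn_const.add contDiffOn_id).log hpos))).cexp
  · have hD := D_eq hρ (((((hasDerivAt_id' ρ).const_add 1).log (hpos ρ hρ)).ofReal_comp.const_mul
      (-μ)).cexp).hasDerivWithinAt
    have h0 : (1 : ℂ) + ρ ≠ 0 := by exact_mod_cast hpos ρ hρ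
    rw [hD, Complex.ofReal_div, Complex.ofReal_one, Complex.ofReal_add, Complex.ofReal_one]
    field_simp
    ring

theorem exists_transport_solution {μ : ℂ} (hμ : 0 < μ.re) (F : ℂ[X]) (q₀ : ℂ) {n : ℕ}
    (hn : 1 ≤ n) : ∃ q : ℝ → ℂ, ContDiffOn ℝ n q I ∧ q 0 = q₀ ∧
      ∀ ρ ∈ I, μ * q ρ + (ρ + 1) * D q ρ = F.eval (ρ : ℂ) := by
  obtain ⟨Q, hQ⟩ := exists_C_mul_add_X_add_C_mul_derivative_eq (add_natCast_ne_zero hμ) 1 F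
  obtain ⟨e, he, he0, heq⟩ := exists_homogeneous_transport_solution μ n
  refine ⟨fun ρ => Q.eval (ρ : ℂ) + (q₀ - Q.eval 0) * e ρ,
    (contDiffOn_eval Q).add (contDiffOn_const.mul he), by simp [he0], fun ρ hρ => ?_⟩
  have hQρ : μ * Q.eval (ρ : ℂ) + (ρ + 1) * Q.derivative.eval (ρ : ℂ) = F.eval (ρ : ℂ) := by
    simpa using congrArg (eval (ρ : ℂ)) hQ
  have hD : D (fun ρ => Q.eval (ρ : ℂ) + (q₀ - Q.eval 0) * e ρ) ρ =
      Q.derivative.eval (ρ : ℂ) + (q₀ - Q.eval 0) * D e ρ :=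
    D_eq hρ ((hasD_eval Q ρ).add ((hasD he hn hρ).const_mul _))
  rw [hD]
  linear_combination hQρ + (q₀ - Q.eval 0) * heq ρ hρ

/-- The Riemann invariants `p = a + b` and `q = a - b` decouple the system; `p` is a polynomial,
since `ρ - 1` is singular at the light cone, and `q` restores the boundary condition. -/
theorem exists_symmetric_hyperbolic_solution {z : ℂ} (hz : -1 < z.re) (F G : ℂ[X]) {n : ℕ}
    (hn : 1 ≤ n) : ∃ a b : ℝ → ℂ, ContDiffOn ℝ n a I ∧ ContDiffOn ℝ n b I ∧ a 0 = 0 ∧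
      ∀ ρ ∈ I, z * a ρ - (-a ρ - ρ * D a ρ + D b ρ) = F.eval (ρ : ℂ) ∧
        z * b ρ - (D a ρ - b ρ - ρ * D b ρ) = G.eval (ρ : ℂ) := by
  have hμ : 0 < (z + 1).re := by simpa using by linarith
  obtain ⟨P, hP⟩ := exists_C_mul_add_X_add_C_mul_derivative_eq (add_natCast_ne_zero hμ) (-1) (F + G)
  obtain ⟨q, hq, hq0, hqeq⟩ := exists_transport_solution hμ (F - G) (-P.eval 0) hn
  refine ⟨fun ρ => (P.eval (ρ : ℂ) + q ρ) / 2, fun ρ => (P.eval (ρ : ℂ) - q ρ) / 2,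
    ((contDiffOn_eval P).add hq).div_const 2, ((contDiffOn_eval P).sub hq).div_const 2,
    by simp [hq0], fun ρ hρ => ?_⟩
  have hPρ : (z + 1) * P.eval (ρ : ℂ) + (ρ - 1) * P.derivative.eval (ρ : ℂ) =
      F.eval (ρ : ℂ) + G.eval (ρ : ℂ) := by
    simpa [sub_eq_add_neg] using congrArg (eval (ρ : ℂ)) hP
  have hqρ := hqeq ρ hρ
  rw [eval_sub] at hqρ
  have hDa : D (fun ρ => (P.eval (ρ : ℂ) + q ρ) / 2) ρ =
      (P.derivative.eval (ρ : ℂ) + D q ρ) / 2 :=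
    D_eq hρ (((hasD_eval P ρ).add (hasD hq hn hρ)).div_const 2)
  have hDb : D (fun ρ => (P.eval (ρ : ℂ) - q ρ) / 2) ρ =
      (P.derivative.eval (ρ : ℂ) - D q ρ) / 2 :=
    D_eq hρ (((hasD_eval P ρ).sub (hasD hq hn hρ)).div_const 2)
  rw [hDa, hDb]
  constructor
  · linear_combination (hPρ + hqρ) / 2
  · linear_combination (hPρ - hqρ) / 2

theorem exists_smul_sub_L0fun_eq_ofPoly {z : ℂ} (hz : -1 < z.re) (F G : ℂ[X]) :
    ∃ u : domL0t, z • u.1 - L0fun u = ofPoly F G := by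
  obtain ⟨a, b, ha, hb, ha0, h⟩ := exists_symmetric_hyperbolic_solution hz F G one_le_two
  let u : domL0t := ⟨_, ofDeriv_mem_domL0t ha hb ha0⟩
  have ha₁ : ContDiffOn ℝ (1 : ℕ) a I := ha.of_le (mod_cast one_le_two)
  have hua : EqOn u.1.fst.weightedD a I := fun ρ hρ => by
    rcases eq_or_ne ρ 0 with rfl | h0
    · rw [H1t.weightedD_zero, ha0]
    · exact H1t.weightedD_ofWeightedD ha₁ hρ h0
  have hub : EqOn (D u.1.snd.fn) b I := fun ρ hρ => H2t.D_ofD hb.continuousOn hρ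
  refine ⟨u, ext_of_weightedD_eq (fun ρ hρ => ?_) fun ρ hρ => ?_⟩
  all_goals have hρ' := Ioo_subset_Icc_self hρ
  · rw [WithLp.sub_fst, WithLp.smul_fst, H1t.weightedD_smul_sub _ _ _ hρ',
      weightedD_L0fun _ hρ' hρ.1.ne', hua hρ', D_congr hua hρ', D_congr hub hρ',
      weightedD_ofPoly _ _ hρ' hρ.1.ne']
    exact (h ρ hρ').1
  · rw [WithLp.sub_snd, WithLp.smul_snd, H2t.D_smul_sub _ _ _ hρ', D_L0fun_snd _ hρ', hub hρ',
      D_congr hua hρ', D_congr hub hρ', D_ofPoly_snd _ _ hρ']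
    exact (h ρ hρ').2

theorem denseRange_smul_sub_L0fun {z : ℂ} (hz : -1 < z.re) :
    DenseRange fun u : domL0t => z • u.1 - L0fun u := by
  refine Dense.mono ?_ dense_range_ofPoly
  rintro _ ⟨⟨F, G⟩, rfl⟩
  exact exists_smul_sub_L0fun_eq_ofPoly hz F G

end Range

section Perturbation

theorem H1t.weightedD_smul (z : ℂ) (u : H1t) {ρ : ℝ} (hρ : ρ ∈ I) :
    (z • u).weightedD ρ = z * u.weightedD ρ := by
  rw [H1t.weightedD, map_smul, D_smul one_le_two z u.mem.1.1 hρ, mul_div_assoc, H1t.weightedD]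

theorem H2t.D_smul (z : ℂ) (u : H2t) {ρ : ℝ} (hρ : ρ ∈ I) :
    D (z • u).fn ρ = z * D u.fn ρ := by
  rw [map_smul, WaveMap.D_smul le_rfl z u.mem.1.1 hρ]

theorem norm_fn_le (u : H1t) {ρ : ℝ} (hρ : ρ ∈ I) : ‖u.fn ρ‖ ≤ ‖u‖ := by
  let v : H2t := H2t.mk u.fn
    ⟨⟨u.mem.1.1.of_le (mod_cast one_le_two), u.mem.1.2⟩, u.mem.2.1⟩
  refine (norm_le2 v hρ).trans (le_of_sq_le_sq ?_ (norm_nonneg u))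
  rw [norm_sq1, norm_sq2]
  refine intervalIntegral.integral_mono_on_of_le_Ioo zero_le_one (integrable2_self v)
    (integrable1_self u) fun r hr => ?_
  exact le_div_self (sq_nonneg _) (pow_pos hr.1 2) (pow_le_one₀ hr.1.le hr.2.le)

theorem abs_V₁_le (ρ : ℝ) : |V₁ ρ| ≤ 16 := by
  rw [V₁, abs_div, abs_neg, abs_of_pos (by positivity : 0 < (1 + ρ ^ 2) ^ 2),
    abs_of_pos (by norm_num : (0 : ℝ) < 16)]
  exact div_le_self (by norm_num) (one_le_pow₀ (by linarith [sq_nonneg ρ]))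

theorem deriv_V₁ (ρ : ℝ) : deriv V₁ ρ = 64 * ρ / (1 + ρ ^ 2) ^ 3 := by
  have h0 : 1 + ρ ^ 2 ≠ 0 := by positivity
  have hV := (((hasDerivAt_pow 2 ρ).const_add 1).pow 2).fun_inv (pow_ne_zero 2 h0)
    |>.const_mul (-16)
  refine (hV.congr_deriv ?_).deriv
  simp only [Nat.cast_ofNat, Nat.add_one_sub_one, pow_one, Pi.pow_apply, neg_mul]
  field_simp
  ring

theorem abs_deriv_V₁_le {ρ : ℝ} (hρ : 0 ≤ ρ) : |deriv V₁ ρ| ≤ 64 * ρ := by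
  rw [deriv_V₁, abs_of_nonneg (by positivity)]
  exact div_le_self (by positivity) (one_le_pow₀ (by linarith [sq_nonneg ρ]))

/-- The pair `(K u, 0)`. Its norm in `H̃` is the `L²` norm of `u`, the weak norm of the second
component by which `L'` is controlled. -/
noncomputable def KFun (u : H2t) : Ht :=
  ofDeriv u.fn 0 u.mem.1.1 continuousOn_const

theorem KFun_fst_fn (u : H2t) {ρ : ℝ} (hρ : ρ ∈ I) : (KFun u).fst.fn ρ = K u.fn ρ :=
  indicator_of_mem hρ _

theorem weightedD_KFun (u : H2t) {ρ : ℝ} (hρ : ρ ∈ I) (h0 : ρ ≠ 0) :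
    (KFun u).fst.weightedD ρ = u.fn ρ :=
  H1t.weightedD_ofWeightedD u.mem.1.1 hρ h0

theorem D_KFun_snd (u : H2t) {ρ : ℝ} (hρ : ρ ∈ I) : D (KFun u).snd.fn ρ = 0 :=
  H2t.D_ofD continuousOn_const hρ

theorem norm_weightedD_LpFun_le (u : Ht) {ρ : ℝ} (hρ : ρ ∈ Ioo (0 : ℝ) 1) :
    ‖(LpFun u).fst.weightedD ρ‖ ≤ 64 * ‖KFun u.snd‖ + 16 * ‖u.snd.fn ρ‖ := by
  have hρ' := Ioo_subset_Icc_self hρ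
  have hpos : 0 < ρ := hρ.1
  have hK : ‖K u.snd.fn ρ‖ ≤ ‖KFun u.snd‖ := by
    rw [← KFun_fst_fn _ hρ']
    exact (norm_fn_le _ hρ').trans (WithLp.norm_fst_le _ _)
  have hD : D (LpFun u).fst.fn ρ = _ := lp1_hasD u.snd.mem.1.1.continuousOn hρ'
  rw [H1t.weightedD, hD, norm_div, Complex.norm_of_nonneg hpos.le, div_le_iff₀ hpos]
  calc _ ≤ _ := norm_add_le _ _
    _ = |deriv V₁ ρ| * ‖K u.snd.fn ρ‖ + |V₁ ρ| * (ρ * ‖u.snd.fn ρ‖) := by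
      simp only [norm_mul, norm_neg, Complex.norm_real, Real.norm_eq_abs, abs_of_pos hpos]
    _ ≤ 64 * ρ * ‖KFun u.snd‖ + 16 * (ρ * ‖u.snd.fn ρ‖) := by
      gcongr
      · exact abs_deriv_V₁_le hpos.le
      · exact abs_V₁_le ρ
    _ = _ := by ring

theorem norm_LpFun_le (u : Ht) : ‖LpFun u‖ ≤ 96 * ‖KFun u.snd‖ := by
  have hsq : ‖LpFun u‖ ^ 2 ≤ 2 * (64 * ‖KFun u.snd‖) ^ 2 + 512 * ‖KFun u.snd‖ ^ 2 := by
    refine norm_sq_le_of_sq_add_sq_le fun ρ hρ => ?_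
    have hρ' := Ioo_subset_Icc_self hρ
    have hsnd : D (LpFun u).snd.fn ρ = 0 := by simp [LpFun, D]
    rw [hsnd, weightedD_KFun _ hρ' hρ.1.ne', D_KFun_snd _ hρ', norm_zero]
    have h := pow_le_pow_left₀ (norm_nonneg _) (norm_weightedD_LpFun_le u hρ) 2
    linarith [add_sq_le (a := 64 * ‖KFun u.snd‖) (b := 16 * ‖u.snd.fn ρ‖)]
  exact le_of_sq_le_sq (by nlinarith [sq_nonneg ‖KFun u.snd‖]) (by positivity)

theorem L0fun_snd_fn (u : domL0t) {ρ : ℝ} (hρ : ρ ∈ I) :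
    (L0fun u).snd.fn ρ = u.1.fst.weightedD ρ - ρ * D u.1.snd.fn ρ :=
  indicator_of_mem hρ fun ρ => D u.1.fst.fn ρ / ρ - ρ * D u.1.snd.fn ρ

/-- The second row of the resolvent equation `z u - L̃₀ u = f` gains a factor `z⁻¹` on `u₂`. -/
theorem norm_smul_KFun_le (z : ℂ) (u : domL0t) :
    ‖z • KFun u.1.snd‖ ≤ 2 * (‖u.1‖ + ‖z • u.1 - L0fun u‖) := by
  set f := z • u.1 - L0fun u with hf
  have hsq : ‖z • KFun u.1.snd‖ ^ 2 ≤ 3 * ‖f‖ ^ 2 + 3 * ‖u.1‖ ^ 2 := by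
    refine norm_sq_le_of_sq_add_sq_le fun ρ hρ => ?_
    have hρ' := Ioo_subset_Icc_self hρ
    have hrow : z * u.1.snd.fn ρ =
        f.snd.fn ρ + u.1.fst.weightedD ρ - ρ * D u.1.snd.fn ρ := by
      have : f.snd.fn ρ = z * u.1.snd.fn ρ - (L0fun u).snd.fn ρ := by simp [hf]
      rw [this, L0fun_snd_fn u hρ']
      ring
    have hf₂ : ‖f.snd.fn ρ‖ ≤ ‖f‖ := (norm_le2 _ hρ').trans (WithLp.norm_snd_le _ _)
    have hρD : ‖ρ * D u.1.snd.fn ρ‖ ≤ ‖D u.1.snd.fn ρ‖ := by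
      rw [norm_mul, Complex.norm_of_nonneg hρ.1.le]
      exact mul_le_of_le_one_left (norm_nonneg _) hρ.2.le
    have hnorm : ‖z * u.1.snd.fn ρ‖ ≤ ‖f‖ + ‖u.1.fst.weightedD ρ‖ + ‖D u.1.snd.fn ρ‖ := by
      rw [hrow]
      exact (norm_sub_le _ _).trans (add_le_add ((norm_add_le _ _).trans (by gcongr)) hρD)
    rw [WithLp.smul_fst, WithLp.smul_snd, H1t.weightedD_smul _ _ hρ', H2t.D_smul _ _ hρ',
      weightedD_KFun _ hρ' hρ.1.ne', D_KFun_snd _ hρ', mul_zero, norm_zero]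
    have h := pow_le_pow_left₀ (norm_nonneg _) hnorm 2
    nlinarith [sq_nonneg (‖f‖ - ‖u.1.fst.weightedD ρ‖), sq_nonneg (‖f‖ - ‖D u.1.snd.fn ρ‖),
      sq_nonneg (‖u.1.fst.weightedD ρ‖ - ‖D u.1.snd.fn ρ‖)]
  exact le_of_sq_le_sq (by nlinarith [norm_nonneg u.1, norm_nonneg f]) (by positivity)

end Perturbation

section Completion

theorem norm_emb (u : Ht) : ‖emb u‖ = ‖u‖ := UniformSpace.Completion.norm_coe u

theorem exists_L0t_eq (x : L0t.domain) :
    ∃ u : domL0t, emb u.1 = (x : H) ∧ emb (L0fun u) = L0t x := by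
  obtain ⟨_, u, hu, rfl⟩ := x
  exact ⟨⟨u, hu⟩, rfl, (L0t_apply ⟨u, hu⟩).symm⟩

theorem dense_domain_L0t : Dense (L0t.domain : Set H) :=
  UniformSpace.Completion.denseRange_coe.dense_image emb.continuous dense_domL0t

theorem isQuasidissipative_L0t : IsQuasidissipative L0t (-(1 / 2)) := fun x => by
  obtain ⟨u, hx, hL⟩ := exists_L0t_eq x
  have hinner : ⟪emb u.1, emb (L0fun u)⟫_ℂ = ⟪u.1, L0fun u⟫_ℂ :=
    UniformSpace.Completion.inner_coe _ _
  rw [quasidissipativeSet, mem_ofPred_eq, ← hx, ← hL, hinner, norm_emb]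
  exact re_inner_L0fun_le u

theorem denseRange_smul_sub_L0t {z : ℂ} (hz : -1 < z.re) :
    DenseRange fun x : L0t.domain => z • (x : H) - L0t x := by
  refine (UniformSpace.Completion.denseRange_coe.dense_image emb.continuous
    (denseRange_smul_sub_L0fun hz)).mono ?_
  rintro _ ⟨_, ⟨u, rfl⟩, rfl⟩
  refine ⟨⟨emb u.1, Submodule.mem_map_of_mem u.2⟩, ?_⟩
  simp only [L0t_apply]
  exact (by rw [map_sub, map_smul] : emb (z • u.1 - L0fun u) = z • emb u.1 - emb (L0fun u)).symm

theorem exists_isResolventAt_L0 {z : ℂ} (hz : -(1 / 2) < z.re) :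
    ∃ R : H →L[ℂ] H, IsResolventAt L0 z R ∧ ‖R‖ ≤ 1 / (z.re - -(1 / 2)) :=
  isQuasidissipative_L0t.exists_isResolventAt_closure dense_domain_L0t hz
    (denseRange_smul_sub_L0t (by linarith))

theorem norm_mul_norm_LpFun_le (z : ℂ) (u : domL0t) :
    ‖z‖ * ‖LpFun u.1‖ ≤ 192 * (‖u.1‖ + ‖z • u.1 - L0fun u‖) :=
  calc ‖z‖ * ‖LpFun u.1‖ ≤ ‖z‖ * (96 * ‖KFun u.1.snd‖) := by gcongr; exact norm_LpFun_le _
    _ = 96 * ‖z • KFun u.1.snd‖ := by rw [norm_smul]; ring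
    _ ≤ 96 * (2 * (‖u.1‖ + ‖z • u.1 - L0fun u‖)) := by gcongr; exact norm_smul_KFun_le z u
    _ = _ := by ring

theorem norm_mul_norm_Lp_le (z : ℂ) (x : L0.domain) :
    ‖z‖ * ‖Lp (x : H)‖ ≤ 192 * (‖(x : H)‖ + ‖z • (x : H) - L0 x‖) := by
  refine relative_bound_closure (isQuasidissipative_L0t.isClosable dense_domain_L0t) Lp
    (fun x => ?_) x
  obtain ⟨u, hx, hL⟩ := exists_L0t_eq x
  have hsub : z • (x : H) - L0t x = emb (z • u.1 - L0fun u) := by rw [map_sub, map_smul, hx, hL]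
  rw [hsub, ← hx, Lp_emb, norm_emb, norm_emb, norm_emb]
  exact norm_mul_norm_LpFun_le z u

theorem exists_isResolventAt_L {ε : ℝ} (hε : 0 < ε) {z : ℂ} (hz : -(1 / 2) + ε ≤ z.re)
    (hzM : 384 * (1 / ε + 1) ≤ ‖z‖) :
    ∃ R : H →L[ℂ] H, IsResolventAt L z R ∧ ‖R‖ ≤ 2 / ε := by
  obtain ⟨R, hR, hRz⟩ := exists_isResolventAt_L0 (z := z) (by linarith)
  have hRε : ‖R‖ ≤ 1 / ε := hRz.trans (one_div_le_one_div_of_le hε (by linarith))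
  have hz0 : 0 < ‖z‖ := hzM.trans_lt' (by positivity)
  have hsmall : ‖Lp ∘L R‖ ≤ 1 / 2 :=
    (norm_comp_le_of_relative_bound hR hz0 (by norm_num) (norm_mul_norm_Lp_le z)).trans
      ((div_le_iff₀ hz0).2 (by linarith))
  obtain ⟨S, hS, hSR⟩ := exists_isResolventAt_vadd hR one_half_lt_one hsmall
  refine ⟨S, hS, hSR.trans ?_⟩
  calc ‖R‖ / (1 - 1 / 2) = 2 * ‖R‖ := by ring
    _ ≤ 2 * (1 / ε) := by gcongr
    _ = 2 / ε := by ring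

theorem mem_opResolventSet_and_norm_opResolvent_le {E : Type*} [NormedAddCommGroup E]
    [NormedSpace ℂ E] {A : E →ₗ.[ℂ] E} {z : ℂ} {C : ℝ}
    (h : ∃ R : E →L[ℂ] E, IsResolventAt A z R ∧ ‖R‖ ≤ C) :
    z ∈ opResolventSet A ∧ ‖opResolvent A z‖ ≤ C := by
  obtain ⟨R, hR, hC⟩ := h
  have hz : z ∈ opResolventSet A := ⟨R, hR⟩
  exact ⟨hz, (isResolventAt_opResolvent hz).unique hR ▸ hC⟩

end Completion

end WaveMap

theorem lemma4p16 :
    (∀ ε : ℝ, 0 < ε →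
      (∃ M C : ℝ, ∀ z : ℂ, -(1 / 2) + ε ≤ z.re → M ≤ ‖z‖ →
        z ∈ WaveMap.opResolventSet WaveMap.L ∧ ‖WaveMap.opResolvent WaveMap.L z‖ ≤ C) ∧
      (∃ N : ℝ, ∀ z : ℂ, -(1 / 2) + ε ≤ z.re → N ≤ |z.im| →
        z ∉ WaveMap.opSpectrum WaveMap.L)) ∧
    (∃ N : ℝ, ∀ z : ℂ, 0 ≤ z.re → N ≤ |z.im| → z ∉ WaveMap.opPointSpectrum WaveMap.L) := by
  have resolvent_bound (ε : ℝ) (hε : 0 < ε) (z : ℂ) (hz : -(1 / 2) + ε ≤ z.re)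
      (hM : 384 * (1 / ε + 1) ≤ ‖z‖) :=
    WaveMap.mem_opResolventSet_and_norm_opResolvent_le (WaveMap.exists_isResolventAt_L hε hz hM)
  refine ⟨fun ε hε => ⟨⟨_, _, resolvent_bound ε hε⟩, 384 * (1 / ε + 1), fun z hz hN => ?_⟩,
    384 * (1 / (1 / 2) + 1), fun z hz hN => ?_⟩
  · exact not_not.2 (resolvent_bound ε hε z hz (hN.trans (Complex.abs_im_le_norm z))).1
  · exact WaveMap.notMem_opPointSpectrum_of_mem_opResolventSet
      (resolvent_bound (1 / 2) one_half_pos z (by linarith)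
        (hN.trans (Complex.abs_im_le_norm z))).1
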